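/- For real numbers $\tilde p,\tilde q$ let $$Q_{\tilde p\tilde q}(t)=t^{10}+(2q^2+p^2)(3q^2-2p^2)\,t^8+(q^8+10p^2q^6+4p^4q^4-14p^6q^2+p^8)\,t^6-p^2q^2(q^8-14p^2q^6+4p^4q^4+10p^6q^2+p^8)\,t^4-p^6q^6(q^2+2p^2)(3p^2-2q^2)\,t^2-q^{10}p^{10},$$ where $p=\tilde p+\tilde q$ and $q=\tilde q$. Say that $t\in\mathbb C$ is *selected* if $t>0$ in the case where $t$ is real, and $\operatorname{Im} t>0$ in the case where $t$ is not real. The quartic $u^4+8u^2-12\,\mathrm i\,u-4$ has four simple roots $u_2,u_3,u_4,u_5\in\mathbb C$, which, with an error less than $10^{-9}$ in absolute value, are $$u_2\approx 0.4863801704\,\mathrm i,\quad u_3\approx-3.439109107\,\mathrm i,\quad u_4\approx 0.4600767354+1.476364468\,\mathrm i,\quad u_5\approx-0.4600767354+1.476364468\,\mathrm i.$$ Let $\tilde q\ge 97|\tilde p|\neq 0$. Define five sites in $\mathbb C$ as follows. The first site $S_1$ is the real interval $$\tilde q^2+5\tilde p\tilde q+10\tilde p^2-\frac{74|\tilde p|^3}{\tilde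 q}<t<\tilde q^2+5\tilde p\tilde q+10\tilde p^2\quad\text{if }\tilde p>0,$$ $$\tilde q^2+5\tilde p\tilde q+10\tilde p^2<t<\tilde q^2+5\tilde p\tilde q+10\tilde p^2+\frac{74|\tilde p|^3}{\tilde q}\quad\text{if }\tilde p<0,$$ and for $i=2,3,4,5$ the site $S_i$ is the open disk $$\Bigl|\,t-\mathrm i\,\tilde q^2-u_i\,\tilde p\,\tilde q+\frac{u_i+\mathrm i\,u_i^2}{2}\,\tilde p^2\Bigr|<\frac{51|\tilde p|^3}{\tilde q}.$$ **Theorem.** The sites $S_1,\dots,S_5$ are pairwise disjoint. The polynomial $Q_{\tilde p\tilde q}$ has exactly five selected roots $t_1,\dots,t_5$; they are distinct and simple, and for each $i$ the root $t_i$ lies in $S_i$ and is the only root of $Q_{\tilde p\tilde q}$ in $S_i$. The ten roots of $Q_{\tilde p\tilde q}$, counted with multiplicity, are $t_1,\dots,t_5,-t_1,\dots,-t_5$. -/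

import Mathlib

open Polynomial

noncomputable section

/-- The cuboid characteristic polynomial `Q_{pq}(t)` of the second cuboid conjecture, as a
polynomial in `t` over `ℂ` with real parameters `p`, `q`. -/
def cuboidPoly (p q : ℝ) : ℂ[X] :=
  X ^ 10
    + C (((2 * q ^ 2 + p ^ 2) * (3 * q ^ 2 - 2 * p ^ 2) : ℝ) : ℂ) * X ^ 8
    + C ((q ^ 8 + 10 * p ^ 2 * q ^ 6 + 4 * p ^ 4 * q ^ 4 - 14 * p ^ 6 * q ^ 2 + p ^ 8 : ℝ) : ℂ)
      * X ^ 6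
    - C ((p ^ 2 * q ^ 2 * (q ^ 8 - 14 * p ^ 2 * q ^ 6 + 4 * p ^ 4 * q ^ 4
        + 10 * p ^ 6 * q ^ 2 + p ^ 8) : ℝ) : ℂ) * X ^ 4
    - C ((p ^ 6 * q ^ 6 * (q ^ 2 + 2 * p ^ 2) * (3 * p ^ 2 - 2 * q ^ 2) : ℝ) : ℂ) * X ^ 2
    - C ((q ^ 10 * p ^ 10 : ℝ) : ℂ)

/-- The transformed tenth-degree polynomial in the new parameters (here called `p`, `q`;
`p` and `q` are the tilded parameters), in explicit form. -/
def transformedPoly (p q : ℝ) : ℂ[X] :=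
  X ^ 10
    + C ((3 * q ^ 4 - 10 * q ^ 3 * p - 13 * q ^ 2 * p ^ 2 - 8 * p ^ 3 * q - 2 * p ^ 4 : ℝ) : ℂ)
      * X ^ 8
    + C ((p ^ 8 - 40 * q ^ 7 * p - 136 * q ^ 4 * p ^ 4 + 2 * q ^ 8 + 14 * p ^ 6 * q ^ 2
        - 148 * q ^ 6 * p ^ 2 - 208 * q ^ 5 * p ^ 3 + 8 * p ^ 7 * q
        - 28 * p ^ 5 * q ^ 3 : ℝ) : ℂ) * X ^ 6
    - C ((10 * p ^ 9 * q ^ 3 + 302 * q ^ 10 * p ^ 2 + 836 * q ^ 7 * p ^ 5 + 60 * q ^ 11 * p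
        + 200 * p ^ 7 * q ^ 5 + 704 * q ^ 9 * p ^ 3 + p ^ 10 * q ^ 2 + 494 * q ^ 6 * p ^ 6
        + 2 * q ^ 12 + 956 * q ^ 8 * p ^ 4 + 55 * p ^ 8 * q ^ 4 : ℝ) : ℂ) * X ^ 4
    - C ((6 * p ^ 10 * q ^ 6 + 1444 * q ^ 11 * p ^ 5 + 1230 * q ^ 10 * p ^ 6
        + 712 * q ^ 9 * p ^ 7 + 40 * q ^ 15 * p + 1160 * q ^ 12 * p ^ 4 + 624 * q ^ 13 * p ^ 3
        + 269 * q ^ 8 * p ^ 8 + 3 * q ^ 16 + 60 * p ^ 9 * q ^ 7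
        + 212 * q ^ 14 * p ^ 2 : ℝ) : ℂ) * X ^ 2
    + C ((-210 * q ^ 16 * p ^ 4 - q ^ 10 * p ^ 10 - q ^ 20 - 210 * q ^ 14 * p ^ 6
        - 120 * q ^ 13 * p ^ 7 - 45 * q ^ 12 * p ^ 8 - 10 * q ^ 11 * p ^ 9 - 10 * q ^ 19 * p
        - 120 * q ^ 17 * p ^ 3 - 252 * q ^ 15 * p ^ 5 - 45 * q ^ 18 * p ^ 2 : ℝ) : ℂ)

/-- The transformed polynomial is the characteristic polynomial after the change of parameters
`(p, q) ↦ (p + q, q)`. -/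
theorem transformedPoly_eq (p q : ℝ) : transformedPoly p q = cuboidPoly (p + q) q := by
  simp only [transformedPoly, cuboidPoly]
  push_cast
  simp only [map_add, map_sub, map_mul, map_pow, map_neg, map_ofNat]
  ring

/-- The condition selecting one root of each pair `{t, -t}`: `t > 0` if `t` is real, and
`Im t > 0` if `t` is not real. -/
def IsSelected (t : ℂ) : Prop :=
  (t.im = 0 → 0 < t.re) ∧ (t.im ≠ 0 → 0 < t.im)

/-- The quartic `u⁴ + 8 u² - 12 i u - 4` whose roots enter the centers of the four disks. -/
def centerQuartic : ℂ[X] :=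
  X ^ 4 + C 8 * X ^ 2 - C (12 * Complex.I) * X - C 4

/-- The real asymptotic interval (one of two, according to the sign of `p`), as a set of real
points of `ℂ`. -/
def realSite (p q : ℝ) : Set ℂ :=
  {z | ∃ t : ℝ, z = (t : ℂ) ∧
    ((0 < p ∧ q ^ 2 + 5 * p * q + 10 * p ^ 2 - 74 * |p| ^ 3 / q < t ∧
        t < q ^ 2 + 5 * p * q + 10 * p ^ 2) ∨
      (p < 0 ∧ q ^ 2 + 5 * p * q + 10 * p ^ 2 < t ∧
        t < q ^ 2 + 5 * p * q + 10 * p ^ 2 + 74 * |p| ^ 3 / q))}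

/-- The complex asymptotic disk belonging to a root `u` of the quartic. -/
def diskSite (u : ℂ) (p q : ℝ) : Set ℂ :=
  {t | ‖t - Complex.I * (q : ℂ) ^ 2 - u * (p : ℂ) * (q : ℂ)
      + (u + Complex.I * u ^ 2) / 2 * (p : ℂ) ^ 2‖ < 51 * |p| ^ 3 / q}

/-- The five asymptotic sites: the real interval and the four disks. -/
def site (u₂ u₃ u₄ u₅ : ℂ) (p q : ℝ) : Fin 5 → Set ℂ :=
  ![realSite p q, diskSite u₂ p q, diskSite u₃ p q, diskSite u₄ p q, diskSite u₅ p q]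

end

/-!
By homogeneity the parameters `(p, q)` may be replaced by `(x, 1)` with `x = p / q`, so `|x| ≤ 1/97`.
The polynomial is then `F (t ^ 2)` with `F = charForm x` of degree five, and at `x = 0` it is
`(t ^ 2 - 1) (t ^ 2 + 1) ^ 4`.

Since the polynomial is even of degree ten, it is enough to find one root in each of the five sites:
the sites are pairwise disjoint and consist of selected points, so the five roots and their opposites
are ten distinct roots, which leaves no room for others or for multiplicities
(`roots_of_disjoint_selected`). Neither Rouché's theorem nor uniqueness inside a site is needed.

For the real site, `t = 1 + 5 x + 10 x² + k x³` gives `F (t ^ 2) = x³ (16 m - 384 + O(x))`, where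
`m` is `100 + 2 k` to leading order, and the sign changes between `k = -74` and `k = 0`.

For the disks, write `u = i v` and `t = i σ`, which makes all coefficients rational integers:
`v ^ 4 - 8 v ^ 2 + 12 v - 4 = 0` and `σ = 1 + v x + (v² - v) / 2 x² + k x³`. The equation for `v`
and the coefficient of `x²` are exactly what makes the terms of order `x⁴` and `x⁵` of `F (-σ ^ 2)`
vanish (`charForm_expansion`). For the two real `v` the polynomial is real on the imaginary axis, and
it changes sign along the vertical diameter `-51 ≤ k ≤ 51` of the disk. For the complex `v` a root
lies in the disk because `|P c|` is small against `|P' c|` at the center `c`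
(`exists_isRoot_near`). The disk of the conjugate of `v` is the mirror image in the imaginary axis.
-/

/-! ### Locating and counting roots -/

/-- A polynomial of degree at most `n` has a root within distance `n * ‖P c‖ / ‖P' c‖` of `c`:
otherwise the logarithmic derivative `P' c / P c = ∑ 1 / (c - z)`, a sum of at most `n` terms,
would be too small. -/
theorem exists_isRoot_near {P : ℂ[X]} {n : ℕ} (hn : P.natDegree ≤ n) {c : ℂ} {r : ℝ}
    (h : n * ‖P.eval c‖ < r * ‖P.derivative.eval c‖) : ∃ z, P.IsRoot z ∧ ‖z - c‖ < r := by
  have hr : 0 < r := by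
    by_contra! hr
    have h1 := mul_nonpos_of_nonpos_of_nonneg hr (norm_nonneg (P.derivative.eval c))
    have h2 : 0 ≤ n * ‖P.eval c‖ := by positivity
    linarith
  by_cases hc : P.eval c = 0
  · exact ⟨c, hc, by simpa using hr⟩
  by_contra! hfar
  have hlog := (IsAlgClosed.splits P).eval_derivative_div_eval_of_ne_zero hc
  have hterm : ∀ w ∈ P.roots.map (fun z => ‖1 / (c - z)‖), w ≤ 1 / r := by
    intro w hw
    obtain ⟨z, hz, rfl⟩ := Multiset.mem_map.1 hw
    rw [norm_div, norm_one, norm_sub_rev]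
    exact one_div_le_one_div_of_le hr (hfar z (isRoot_of_mem_roots hz))
  have hsum : ‖P.derivative.eval c / P.eval c‖ ≤ n * (1 / r) := by
    rw [hlog]
    refine (norm_multiset_sum_le _).trans ?_
    rw [Multiset.map_map]
    refine (Multiset.sum_le_card_nsmul _ _ hterm).trans ?_
    rw [Multiset.card_map, nsmul_eq_mul]
    have : (Multiset.card P.roots : ℝ) ≤ n := by exact_mod_cast (card_roots' P).trans hn
    gcongr
  have hpos : 0 < ‖P.eval c‖ := norm_pos_iff.2 hc
  rw [norm_div, div_le_iff₀ hpos] at hsum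
  have : r * ‖P.derivative.eval c‖ ≤ r * (n * (1 / r) * ‖P.eval c‖) := by gcongr
  have e : r * (n * (1 / r) * ‖P.eval c‖) = n * ‖P.eval c‖ := by field_simp
  linarith

theorem IsSelected.not_neg {z : ℂ} (hz : IsSelected z) : ¬ IsSelected (-z) := by
  intro h
  by_cases hi : z.im = 0
  · have h1 := hz.1 hi
    have h2 := h.1 (by simpa using hi)
    rw [Complex.neg_re] at h2
    linarith
  · have h1 := hz.2 hi
    have h2 := h.2 (by simpa using hi)
    rw [Complex.neg_im] at h2
    linarith

/-- If an even polynomial of degree ten has a root in each of five pairwise disjoint sets of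
selected points, then these roots and their opposites are ten distinct roots, hence all of them. -/
theorem roots_of_disjoint_selected {P : ℂ[X]} (hdeg : P.natDegree = 10)
    (heven : ∀ z, P.IsRoot z → P.IsRoot (-z)) {S : Fin 5 → Set ℂ}
    (hdisj : Pairwise (fun i j => Disjoint (S i) (S j)))
    (hsel : ∀ i, ∀ z ∈ S i, IsSelected z) (hex : ∀ i, ∃ z ∈ S i, P.IsRoot z) :
    ∃ t : Fin 5 → ℂ, Function.Injective t ∧
      (∀ z : ℂ, (P.IsRoot z ∧ IsSelected z) ↔ ∃ i, z = t i) ∧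
      (∀ i, P.rootMultiplicity (t i) = 1) ∧
      (∀ i, ∀ z : ℂ, (P.IsRoot z ∧ z ∈ S i) ↔ z = t i) ∧
      P.roots = Finset.univ.val.map t + Finset.univ.val.map (fun i => -t i) := by
  choose t htS htr using hex
  have hP : P ≠ 0 := by
    rintro rfl
    simp at hdeg
  have hidx : ∀ {i j}, t j ∈ S i → j = i := by
    intro i j h
    by_contra hne
    exact Set.disjoint_left.1 (hdisj hne) (htS j) h
  have hinj : Function.Injective t := fun i j h => hidx (by rw [h]; exact htS j)
  have hts : ∀ i, IsSelected (t i) := fun i => hsel i _ (htS i)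
  have hnodup : (Finset.univ.val.map t + Finset.univ.val.map (fun i => -t i)).Nodup := by
    refine Multiset.nodup_add.2 ⟨Finset.univ.nodup.map hinj,
      Finset.univ.nodup.map (neg_injective.comp hinj), ?_⟩
    rw [Multiset.disjoint_left]
    intro z h1 h2
    obtain ⟨i, -, rfl⟩ := Multiset.mem_map.1 h1
    obtain ⟨j, -, hj⟩ := Multiset.mem_map.1 h2
    exact (hts j).not_neg (hj ▸ hts i)
  have hle : Finset.univ.val.map t + Finset.univ.val.map (fun i => -t i) ≤ P.roots := by
    rw [Multiset.le_iff_subset hnodup]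
    intro z hz
    rw [mem_roots hP]
    rcases Multiset.mem_add.1 hz with h | h
    · obtain ⟨i, -, rfl⟩ := Multiset.mem_map.1 h
      exact htr i
    · obtain ⟨i, -, rfl⟩ := Multiset.mem_map.1 h
      exact heven _ (htr i)
  have hroots : P.roots = Finset.univ.val.map t + Finset.univ.val.map (fun i => -t i) := by
    refine (Multiset.eq_of_le_of_card_le hle ?_).symm
    simpa [hdeg] using card_roots' P
  have hmain : ∀ z, P.IsRoot z ∧ IsSelected z → ∃ i, z = t i := by
    rintro z ⟨hz, hs⟩
    have hmem : z ∈ P.roots := (mem_roots hP).2 hz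
    rw [hroots] at hmem
    rcases Multiset.mem_add.1 hmem with h | h
    · obtain ⟨i, -, rfl⟩ := Multiset.mem_map.1 h
      exact ⟨i, rfl⟩
    · obtain ⟨i, -, rfl⟩ := Multiset.mem_map.1 h
      exact absurd hs (hts i).not_neg
  refine ⟨t, hinj, fun z => ⟨hmain z, ?_⟩, fun i => ?_, fun i z => ⟨?_, ?_⟩, hroots⟩
  · rintro ⟨i, rfl⟩
    exact ⟨htr i, hts i⟩
  · rw [← count_roots]
    exact Multiset.count_eq_one_of_mem (hroots ▸ hnodup) ((mem_roots hP).2 (htr i))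
  · rintro ⟨hz, hzS⟩
    obtain ⟨j, rfl⟩ := hmain z ⟨hz, hsel i z hzS⟩
    rw [hidx hzS]
  · rintro rfl
    exact ⟨htr i, htS i⟩

/-! ### Expansions of the characteristic form -/

/-- The cuboid characteristic polynomial with parameters `(1 + x, 1)`, that is the transformed one
with parameters `(x, 1)`, as a polynomial in `W = t ^ 2`. -/
def charForm {R : Type*} [CommRing R] (x W : R) : R :=
  W ^ 5 + (2 + (1 + x) ^ 2) * (3 - 2 * (1 + x) ^ 2) * W ^ 4
    + (1 + 10 * (1 + x) ^ 2 + 4 * (1 + x) ^ 4 - 14 * (1 + x) ^ 6 + (1 + x) ^ 8) * W ^ 3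
    - (1 + x) ^ 2 * (1 - 14 * (1 + x) ^ 2 + 4 * (1 + x) ^ 4 + 10 * (1 + x) ^ 6 + (1 + x) ^ 8)
      * W ^ 2
    - (1 + x) ^ 6 * (1 + 2 * (1 + x) ^ 2) * (3 * (1 + x) ^ 2 - 2) * W - (1 + x) ^ 10

/-- The derivative of `charForm x W` with respect to `W`. -/
def charFormDeriv {R : Type*} [CommRing R] (x W : R) : R :=
  5 * W ^ 4 + 4 * ((2 + (1 + x) ^ 2) * (3 - 2 * (1 + x) ^ 2)) * W ^ 3
    + 3 * (1 + 10 * (1 + x) ^ 2 + 4 * (1 + x) ^ 4 - 14 * (1 + x) ^ 6 + (1 + x) ^ 8) * W ^ 2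
    - 2 * ((1 + x) ^ 2
      * (1 - 14 * (1 + x) ^ 2 + 4 * (1 + x) ^ 4 + 10 * (1 + x) ^ 6 + (1 + x) ^ 8)) * W
    - (1 + x) ^ 6 * (1 + 2 * (1 + x) ^ 2) * (3 * (1 + x) ^ 2 - 2)

/-- The terms of order at least `x` in `charForm x (1 + 10 x + 45 x² + x³ m) / x³`, divided
by `x`. -/
def realTail {R : Type*} [CommRing R] (x m : R) : R :=
    2016 + 320 * m + x * (94400 + 3968 * m + x * (1191520 + 32032 * m + 32 * m ^ 2 + x *
    (7732416 + 206632 * m + 480 * m ^ 2 + x * (31679232 + 999440 * m + 4816 * m ^ 2 + x *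
    (73237800 + 3776384 * m + 29024 * m ^ 2 + 24 * m ^ 3 + x * (83907372 + 9032872 * m +
    134824 * m ^ 2 + 240 * m ^ 3 + x * (12721849 * m - 42094880 + 373360 * m ^ 2 + 1840 * m ^
    3 + x * (688168 * m ^ 2 - 6540760 - 3548860 * m + 6440 * m ^ 3 + 8 * m ^ 4 + x * (768600 -
    626938 * m - 111536 * m ^ 2 + 17446 * m ^ 3 + 40 * m ^ 4 + x * (89100 + 50380 * m - 22222
    * m ^ 2 - 1548 * m ^ 3 + 212 * m ^ 4 + x * (5985 * m + 1100 * m ^ 2 - 346 * m ^ 3 - 8 * m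
    ^ 4 + m ^ 5 + x * (134 * m ^ 2 + 8 * m ^ 3 - 2 * m ^ 4 + x * (m ^ 3)))))))))))))

theorem charForm_real_expansion {R : Type*} [CommRing R] (x m : R) :
    charForm x (1 + 10 * x + 45 * x ^ 2 + x ^ 3 * m)
      = x ^ 3 * (16 * m - 384 + x * realTail x m) := by
  unfold charForm realTail
  ring

/-- The coefficient of `x ^ 6` in `charForm x (-(1 + x (2 v + x (2 v² - v + x m))))`. -/
def valueLead {R : Type*} [CommRing R] (v m : R) : R :=
    896 * v - 256 - 896 * v ^ 2 + 256 * v ^ 3 - 192 * m + 256 * v * m - 64 * v ^ 3 * m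

/-- The coefficient of `x ^ 7` in `charForm x (-(1 + x (2 v + x (2 v² - v + x m))))`, reduced
modulo the quartic of `v`. -/
def valueNext {R : Type*} [CommRing R] (v m : R) : R :=
    13440 - 43936 * v + 39072 * v ^ 2 - 11520 * v ^ 3 - 1440 * m + 2624 * v * m - 768 * v ^ 2
    * m - 224 * v ^ 3 * m

/-- The terms from `x ^ 8` on in `-charForm x (-(1 + x (2 v + x (2 v² - v + x m))))`, reduced
modulo the quartic of `v` and divided by `x ^ 8`. -/
def valueTail {R : Type*} [CommRing R] (x v m : R) : R :=
    96128 - 316624 * v + 284464 * v ^ 2 - 81696 * v ^ 3 + 2576 * m - 3264 * v * m - 1728 * v ^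
    2 * m + 1776 * v ^ 3 * m - 64 * m ^ 2 + 48 * v ^ 2 * m ^ 2 + x * (791800 * v - 240288 -
    714520 * v ^ 2 + 210560 * v ^ 3 + 14424 * m - 40448 * v * m + 29344 * v ^ 2 * m - 6664 * v
    ^ 3 * m + 128 * m ^ 2 - 576 * v * m ^ 2 + 192 * v ^ 2 * m ^ 2 + 176 * v ^ 3 * m ^ 2 + x *
    (197872 - 648116 * v + 575652 * v ^ 2 - 163440 * v ^ 3 - 30336 * m + 105056 * v * m -
    99872 * v ^ 2 * m + 30736 * v ^ 3 * m + 1712 * m ^ 2 - 4224 * v * m ^ 2 + 1812 * v ^ 2 * m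
    ^ 2 + 312 * v ^ 3 * m ^ 2 + 16 * v * m ^ 3 + x * (36096 - 115680 * v + 97616 * v ^ 2 -
    25368 * v ^ 3 + 39256 * m - 126956 * v * m + 111424 * v ^ 2 * m - 30932 * v ^ 3 * m + 752
    * m ^ 2 + 720 * v * m ^ 2 - 3996 * v ^ 2 * m ^ 2 + 2364 * v ^ 3 * m ^ 2 - 96 * m ^ 3 + 72
    * v * m ^ 3 + 56 * v ^ 2 * m ^ 3 + x * (17496 - 56036 * v + 47326 * v ^ 2 - 12482 * v ^ 3
    + 6808 * m - 21528 * v * m + 17764 * v ^ 2 * m - 3920 * v ^ 3 * m + 4584 * m ^ 2 - 12408 *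
    v * m ^ 2 + 9022 * v ^ 2 * m ^ 2 - 1858 * v ^ 3 * m ^ 2 - 176 * m ^ 3 + 64 * v * m ^ 3 +
    40 * v ^ 2 * m ^ 3 + 80 * v ^ 3 * m ^ 3 + 2 * m ^ 4 + x * (2304 - 7200 * v + 5734 * v ^ 2
    - 1378 * v ^ 3 + 2908 * m - 9196 * v * m + 7422 * v ^ 2 * m - 1520 * v ^ 3 * m + 992 * m ^
    2 - 2136 * v * m ^ 2 + 1368 * v ^ 2 * m ^ 2 - 96 * v ^ 3 * m ^ 2 + 32 * m ^ 3 - 468 * v *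
    m ^ 3 + 434 * v ^ 2 * m ^ 3 - 40 * v ^ 3 * m ^ 3 + 10 * m ^ 4 + 10 * v * m ^ 4 + x * (296
    - 936 * v + 769 * v ^ 2 - 197 * v ^ 3 + 384 * m - 1168 * v * m + 820 * v ^ 2 * m - 72 * v
    ^ 3 * m + 250 * m ^ 2 - 570 * v * m ^ 2 + 480 * v ^ 2 * m ^ 2 - 48 * v ^ 3 * m ^ 2 - 28 *
    m ^ 3 - 16 * v * m ^ 3 + 64 * v ^ 2 * m ^ 3 + 13 * m ^ 4 - 5 * v * m ^ 4 + 10 * v ^ 2 * m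
    ^ 4 + x * (48 * m - 146 * v * m + 103 * v ^ 2 * m - 12 * v ^ 3 * m + 10 * m ^ 2 - 18 * v *
    m ^ 2 + 48 * v ^ 2 * m ^ 2 + 14 * m ^ 3 - 8 * v * m ^ 3 + 16 * v ^ 2 * m ^ 3 + 8 * m ^ 4 +
    m ^ 5 + x * (m ^ 2 - 3 * v * m ^ 2 + 6 * v ^ 2 * m ^ 2 + 8 * m ^ 3 + 2 * m ^ 4 + x * (m ^
    3)))))))))

/-- The coefficient of `x ^ 3` in `charFormDeriv x (-(1 + x (2 v + x (2 v² - v + x m))))`. -/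
def derivLead {R : Type*} [CommRing R] (v : R) : R :=
    192 - 256 * v + 64 * v ^ 3

/-- The coefficient of `x ^ 4` in `charFormDeriv x (-(1 + x (2 v + x (2 v² - v + x m))))`, reduced
modulo the quartic of `v`. -/
def derivNext {R : Type*} [CommRing R] (v : R) : R :=
    1440 - 2624 * v + 768 * v ^ 2 + 224 * v ^ 3

/-- The terms from `x ^ 5` on in `charFormDeriv x (-(1 + x (2 v + x (2 v² - v + x m))))`, reduced
modulo the quartic of `v` and divided by `x ^ 5`. -/
def derivTail {R : Type*} [CommRing R] (x v m : R) : R :=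
    2576 - 3264 * v - 1728 * v ^ 2 + 1776 * v ^ 3 - 128 * m + 96 * v ^ 2 * m + x * (14424 -
    40448 * v + 29344 * v ^ 2 - 6664 * v ^ 3 + 256 * m - 1152 * v * m + 384 * v ^ 2 * m + 352
    * v ^ 3 * m + x * (105056 * v - 30336 - 99872 * v ^ 2 + 30736 * v ^ 3 + 3424 * m - 8448 *
    v * m + 3624 * v ^ 2 * m + 624 * v ^ 3 * m + 48 * v * m ^ 2 + x * (39256 - 126956 * v +
    111424 * v ^ 2 - 30932 * v ^ 3 + 1504 * m + 1440 * v * m - 7992 * v ^ 2 * m + 4728 * v ^ 3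
    * m - 288 * m ^ 2 + 216 * v * m ^ 2 + 168 * v ^ 2 * m ^ 2 + x * (6808 - 21528 * v + 17764
    * v ^ 2 - 3920 * v ^ 3 + 9168 * m - 24816 * v * m + 18044 * v ^ 2 * m - 3716 * v ^ 3 * m -
    528 * m ^ 2 + 192 * v * m ^ 2 + 120 * v ^ 2 * m ^ 2 + 240 * v ^ 3 * m ^ 2 + 8 * m ^ 3 + x
    * (2908 - 9196 * v + 7422 * v ^ 2 - 1520 * v ^ 3 + 1984 * m - 4272 * v * m + 2736 * v ^ 2
    * m - 192 * v ^ 3 * m + 96 * m ^ 2 - 1404 * v * m ^ 2 + 1302 * v ^ 2 * m ^ 2 - 120 * v ^ 3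
    * m ^ 2 + 40 * m ^ 3 + 40 * v * m ^ 3 + x * (384 - 1168 * v + 820 * v ^ 2 - 72 * v ^ 3 +
    500 * m - 1140 * v * m + 960 * v ^ 2 * m - 96 * v ^ 3 * m - 84 * m ^ 2 - 48 * v * m ^ 2 +
    192 * v ^ 2 * m ^ 2 + 52 * m ^ 3 - 20 * v * m ^ 3 + 40 * v ^ 2 * m ^ 3 + x * (48 - 146 * v
    + 103 * v ^ 2 - 12 * v ^ 3 + 20 * m - 36 * v * m + 96 * v ^ 2 * m + 42 * m ^ 2 - 24 * v *
    m ^ 2 + 48 * v ^ 2 * m ^ 2 + 32 * m ^ 3 + 5 * m ^ 4 + x * (2 * m - 6 * v * m + 12 * v ^ 2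
    * m + 24 * m ^ 2 + 8 * m ^ 3 + x * (3 * m ^ 2)))))))))

/-- The quartic of `v` makes the coefficients of `x ^ 4` and `x ^ 5` vanish. -/
theorem charForm_expansion {R : Type*} [CommRing R] {x v m : R}
    (hv : v ^ 4 - 8 * v ^ 2 + 12 * v - 4 = 0) :
    charForm x (-(1 + x * (2 * v + x * (2 * v ^ 2 - v + x * m))))
      = x ^ 6 * (valueLead v m + x * valueNext v m - x ^ 2 * valueTail x v m) := by
  unfold charForm valueLead valueNext valueTail
  linear_combination x ^ 4 * (
    3264 * x ^ 3 - 32 - 96 * x - 160 * v * x - 192 * x ^ 2 - 368 * v * x ^ 2 - 352 * v ^ 2 * x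
    ^ 2 - 1328 * v * x ^ 3 - 448 * v ^ 2 * x ^ 3 - 448 * v ^ 3 * x ^ 3 - 272 * m * x ^ 3 -
    24074 * x ^ 4 + 6840 * v * x ^ 4 - 2624 * v ^ 2 * x ^ 4 - 96 * v ^ 3 * x ^ 4 - 352 * v ^ 4
    * x ^ 4 - 608 * m * x ^ 4 - 512 * v * m * x ^ 4 + 60062 * x ^ 5 - 17770 * v * x ^ 5 + 4928
    * v ^ 2 * x ^ 5 - 2032 * v ^ 3 * x ^ 5 + 160 * v ^ 4 * x ^ 5 - 160 * v ^ 5 * x ^ 5 - 3656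
    * m * x ^ 5 - 384 * v * m * x ^ 5 - 544 * v ^ 2 * m * x ^ 5 - 49469 * x ^ 6 + 13641 * v *
    x ^ 6 - 4162 * v ^ 2 * x ^ 6 + 968 * v ^ 3 * x ^ 6 - 544 * v ^ 4 * x ^ 6 + 80 * v ^ 5 * x
    ^ 6 - 32 * v ^ 6 * x ^ 6 + 7512 * m * x ^ 6 - 3568 * v * m * x ^ 6 + 160 * v ^ 2 * m * x ^
    6 - 320 * v ^ 3 * m * x ^ 6 - 288 * m ^ 2 * x ^ 6 - 9024 * x ^ 7 + 1856 * v * x ^ 7 - 800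
    * v ^ 2 * x ^ 7 + 128 * v ^ 3 * x ^ 7 - 128 * v ^ 4 * x ^ 7 - 9853 * m * x ^ 7 + 2136 * v
    * m * x ^ 7 - 1176 * v ^ 2 * m * x ^ 7 + 160 * v ^ 3 * m * x ^ 7 - 80 * v ^ 4 * m * x ^ 7
    - 240 * v * m ^ 2 * x ^ 7 - 4374 * x ^ 8 + 888 * v * x ^ 8 - 416 * v ^ 2 * x ^ 8 + 64 * v
    ^ 3 * x ^ 8 - 32 * v ^ 4 * x ^ 8 - 1712 * m * x ^ 8 + 192 * v * m * x ^ 8 - 256 * v ^ 2 *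
    m * x ^ 8 - 1012 * m ^ 2 * x ^ 8 + 120 * v * m ^ 2 * x ^ 8 - 80 * v ^ 2 * m ^ 2 * x ^ 8 -
    576 * x ^ 9 + 72 * v * x ^ 9 - 64 * v ^ 2 * x ^ 9 - 728 * m * x ^ 9 + 96 * v * m * x ^ 9 -
    64 * v ^ 2 * m * x ^ 9 - 192 * m ^ 2 * x ^ 9 - 40 * m ^ 3 * x ^ 9 - 74 * x ^ 10 + 12 * v *
    x ^ 10 - 8 * v ^ 2 * x ^ 10 - 96 * m * x ^ 10 - 48 * m ^ 2 * x ^ 10 - 12 * m * x ^ 11) * hv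

theorem charFormDeriv_expansion {R : Type*} [CommRing R] {x v m : R}
    (hv : v ^ 4 - 8 * v ^ 2 + 12 * v - 4 = 0) :
    charFormDeriv x (-(1 + x * (2 * v + x * (2 * v ^ 2 - v + x * m))))
      = x ^ 3 * (derivLead v + x * derivNext v + x ^ 2 * derivTail x v m) := by
  unfold charFormDeriv derivLead derivNext derivTail
  linear_combination x ^ 4 * (
    272 + 608 * x + 512 * v * x + 3656 * x ^ 2 + 384 * v * x ^ 2 + 544 * v ^ 2 * x ^ 2 - 7512
    * x ^ 3 + 3568 * v * x ^ 3 - 160 * v ^ 2 * x ^ 3 + 320 * v ^ 3 * x ^ 3 + 576 * m * x ^ 3 +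
    9853 * x ^ 4 - 2136 * v * x ^ 4 + 1176 * v ^ 2 * x ^ 4 - 160 * v ^ 3 * x ^ 4 + 80 * v ^ 4
    * x ^ 4 + 480 * v * m * x ^ 4 + 1712 * x ^ 5 - 192 * v * x ^ 5 + 256 * v ^ 2 * x ^ 5 +
    2024 * m * x ^ 5 - 240 * v * m * x ^ 5 + 160 * v ^ 2 * m * x ^ 5 + 728 * x ^ 6 - 96 * v *
    x ^ 6 + 64 * v ^ 2 * x ^ 6 + 384 * m * x ^ 6 + 120 * m ^ 2 * x ^ 6 + 96 * x ^ 7 + 96 * m *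
    x ^ 7 + 12 * x ^ 8) * hv

theorem continuous_charForm (x : ℝ) : Continuous (charForm x) := by
  unfold charForm
  fun_prop

theorem eval_transformedPoly (x : ℝ) (s : ℂ) :
    (transformedPoly x 1).eval s = charForm (x : ℂ) (s ^ 2) := by
  simp only [transformedPoly_eq, cuboidPoly, charForm, eval_add, eval_sub, eval_mul, eval_pow,
    eval_X, eval_C]
  push_cast
  ring

theorem eval_derivative_transformedPoly (x : ℝ) (s : ℂ) :
    (transformedPoly x 1).derivative.eval s = 2 * s * charFormDeriv (x : ℂ) (s ^ 2) := by
  simp only [transformedPoly_eq, cuboidPoly, charFormDeriv, derivative_add, derivative_sub,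
    derivative_mul, derivative_X_pow, derivative_C, eval_add, eval_sub, eval_mul, eval_pow,
    eval_X, eval_C, eval_zero]
  push_cast
  ring

theorem isRoot_ofReal_iff {x t : ℝ} :
    (transformedPoly x 1).IsRoot (t : ℂ) ↔ charForm x (t ^ 2) = 0 := by
  rw [IsRoot.def, eval_transformedPoly]
  have : charForm (x : ℂ) ((t : ℂ) ^ 2) = ((charForm x (t ^ 2) : ℝ) : ℂ) := by
    simp [charForm]
  rw [this, Complex.ofReal_eq_zero]

theorem isRoot_I_mul_iff {x : ℝ} {s : ℂ} :
    (transformedPoly x 1).IsRoot (Complex.I * s) ↔ charForm (x : ℂ) (-s ^ 2) = 0 := by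
  rw [IsRoot.def, eval_transformedPoly, mul_pow, Complex.I_sq, neg_one_mul]

theorem isRoot_I_mul_ofReal_iff {x t : ℝ} :
    (transformedPoly x 1).IsRoot (Complex.I * t) ↔ charForm x (-t ^ 2) = 0 := by
  rw [isRoot_I_mul_iff]
  have : charForm (x : ℂ) (-(t : ℂ) ^ 2) = ((charForm x (-t ^ 2) : ℝ) : ℂ) := by
    simp [charForm]
  rw [this, Complex.ofReal_eq_zero]

theorem natDegree_transformedPoly (p q : ℝ) : (transformedPoly p q).natDegree = 10 := by
  unfold transformedPoly
  compute_degree!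

theorem isRoot_neg_transformedPoly {p q : ℝ} {z : ℂ} (hz : (transformedPoly p q).IsRoot z) :
    (transformedPoly p q).IsRoot (-z) := by
  have : (transformedPoly p q).eval (-z) = (transformedPoly p q).eval z := by
    simp only [transformedPoly, eval_add, eval_sub, eval_mul, eval_pow, eval_X, eval_C]
    ring
  rwa [IsRoot.def, this]

/-- The roots of `transformedPoly p q`, an even polynomial with real coefficients, are symmetric
about the imaginary axis. -/
theorem isRoot_neg_conj_transformedPoly {p q : ℝ} {z : ℂ} (hz : (transformedPoly p q).IsRoot z) :
    (transformedPoly p q).IsRoot (-starRingEnd ℂ z) := by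
  apply isRoot_neg_transformedPoly
  have : (transformedPoly p q).eval (starRingEnd ℂ z)
      = starRingEnd ℂ ((transformedPoly p q).eval z) := by
    simp only [transformedPoly, eval_add, eval_sub, eval_mul, eval_pow, eval_X, eval_C, map_add,
      map_sub, map_mul, map_pow, Complex.conj_ofReal]
  rw [IsRoot.def, this, hz, map_zero]

/-- Homogeneity: the roots for the parameters `(x q, q)` are `q ^ 2` times those for `(x, 1)`. -/
theorem isRoot_scale {x q : ℝ} {s : ℂ} (hs : (transformedPoly x 1).IsRoot s) :
    (transformedPoly (x * q) q).IsRoot ((q : ℂ) ^ 2 * s) := by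
  have : (transformedPoly (x * q) q).eval ((q : ℂ) ^ 2 * s)
      = (q : ℂ) ^ 20 * (transformedPoly x 1).eval s := by
    simp only [transformedPoly_eq, cuboidPoly, eval_add, eval_sub, eval_mul, eval_pow, eval_X,
      eval_C]
    push_cast
    ring
  rw [IsRoot.def, this, hs, mul_zero]

/-! ### The real root and the roots on the imaginary axis -/

theorem norm_pow_le_of_le {K : Type*} [RCLike K] {a : K} {A : ℝ} (h : ‖a‖ ≤ A) (n : ℕ) :
    ‖a ^ n‖ ≤ A ^ n := by
  rw [norm_pow]
  gcongr

theorem exists_zero_of_mul_neg {f : ℝ → ℝ} (hf : Continuous f) {a b : ℝ} (hab : a ≤ b)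
    (h : f a * f b < 0) : ∃ c, a < c ∧ c < b ∧ f c = 0 := by
  have hmem : (0 : ℝ) ∈ Set.uIcc (f a) (f b) := by
    rcases mul_neg_iff.1 h with ⟨h1, h2⟩ | ⟨h1, h2⟩
    · exact Set.mem_uIcc.2 (Or.inr ⟨h2.le, h1.le⟩)
    · exact Set.mem_uIcc.2 (Or.inl ⟨h1.le, h2.le⟩)
  obtain ⟨c, hc, hc0⟩ := intermediate_value_uIcc (f := f) hf.continuousOn hmem
  rw [Set.uIcc_of_le hab] at hc
  refine ⟨c, lt_of_le_of_ne hc.1 ?_, lt_of_le_of_ne hc.2 ?_, hc0⟩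
  · rintro rfl
    simp [hc0] at h
  · rintro rfl
    simp [hc0] at h

theorem exists_isRoot_mem_realSite {x : ℝ} (hx : |x| ≤ 1 / 97) (hx0 : x ≠ 0) :
    ∃ z ∈ realSite x 1, (transformedPoly x 1).IsRoot z := by
  have htail : ∀ m : ℝ, ‖m‖ ≤ 102 → |x * realTail x m| ≤ 1000 := by
    intro m hm
    have hx' : ‖x‖ ≤ 1 / 97 := hx
    rw [← Real.norm_eq_abs]
    unfold realTail
    -- The triangle inequality, applied monomial by monomial, builds the bound as the value of the
    -- metavariable introduced by `le_trans`; it is then evaluated numerically.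
    apply le_trans
    · repeat' first
        | exact hx'
        | exact hm
        | exact (RCLike.norm_ofNat _).le
        | with_reducible apply norm_add_le_of_le
        | with_reducible apply norm_sub_le_of_le
        | with_reducible apply norm_mul_le_of_le
        | with_reducible apply norm_pow_le_of_le
    · norm_num
  -- The endpoints of the interval are `k = 0` and `k = -74`, whatever the sign of `x`.
  let f : ℝ → ℝ := fun k => charForm x ((1 + 5 * x + 10 * x ^ 2 + k * x ^ 3) ^ 2)
  have hf : Continuous f := (continuous_charForm x).comp (by fun_prop)
  have key : ∀ k, f k = x ^ 3 *
      (16 * (100 + 2 * k + (100 + 10 * k) * x + 20 * k * x ^ 2 + k ^ 2 * x ^ 3) - 384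
        + x * realTail x
          (100 + 2 * k + (100 + 10 * k) * x + 20 * k * x ^ 2 + k ^ 2 * x ^ 3)) := by
    intro k
    rw [← charForm_real_expansion]
    simp only [f]
    congr 1
    ring
  obtain ⟨hx1, hx2⟩ := abs_le.1 hx
  have hxsq : x ^ 2 ≤ 1 / 9000 := by nlinarith
  have hxcu : |x ^ 3| ≤ 1 / 900000 := by
    rw [abs_pow]
    calc |x| ^ 3 ≤ (1 / 97) ^ 3 := by gcongr
      _ ≤ 1 / 900000 := by norm_num
  obtain ⟨hc1, hc2⟩ := abs_le.1 hxcu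
  have hpos : 0 < x ^ 6 := by positivity
  obtain ⟨k, hk1, hk2, hk⟩ := exists_zero_of_mul_neg hf (a := -74) (b := 0) (by norm_num) (by
    rw [key, key]
    set m₁ : ℝ := 100 + 2 * (-74) + (100 + 10 * (-74)) * x + 20 * (-74) * x ^ 2
      + (-74) ^ 2 * x ^ 3 with hm₁
    set m₂ : ℝ := 100 + 2 * 0 + (100 + 10 * 0) * x + 20 * 0 * x ^ 2 + 0 ^ 2 * x ^ 3 with hm₂
    have b₁ : |m₁ + 48| ≤ 7 := abs_le.2 ⟨by rw [hm₁]; linarith [sq_nonneg x], by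
      rw [hm₁]; linarith [sq_nonneg x]⟩
    have b₂ : |m₂ - 100| ≤ 2 := abs_le.2 ⟨by rw [hm₂]; linarith, by rw [hm₂]; linarith⟩
    rw [abs_le] at b₁ b₂
    have t₁ := abs_le.1 (htail m₁ (abs_le.2 ⟨by linarith, by linarith⟩))
    have t₂ := abs_le.1 (htail m₂ (abs_le.2 ⟨by linarith, by linarith⟩))
    have e₁ : 16 * m₁ - 384 + x * realTail x m₁ < 0 := by linarith
    have e₂ : 0 < 16 * m₂ - 384 + x * realTail x m₂ := by linarith
    have := mul_neg_of_pos_of_neg hpos (mul_neg_of_neg_of_pos e₁ e₂)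
    linarith)
  refine ⟨((1 + 5 * x + 10 * x ^ 2 + k * x ^ 3 : ℝ) : ℂ), ⟨_, rfl, ?_⟩, isRoot_ofReal_iff.2 hk⟩
  rcases lt_or_gt_of_ne hx0 with hneg | hpos'
  · have h3 : x ^ 3 < 0 := Odd.pow_neg (by decide) hneg
    rw [abs_of_neg hneg]
    exact Or.inr ⟨hneg, by nlinarith, by nlinarith⟩
  · have h3 : 0 < x ^ 3 := by positivity
    rw [abs_of_pos hpos']
    exact Or.inl ⟨hpos', by nlinarith, by nlinarith⟩

/-- The center of the disk for `u = i v`, written as `i` times a perturbation of `1`. -/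
theorem mem_diskSite_I_mul_iff {v z : ℂ} {x : ℝ} : z ∈ diskSite (Complex.I * v) x 1 ↔
    ‖z - Complex.I * (1 + v * x + (v ^ 2 - v) / 2 * x ^ 2)‖ < 51 * |x| ^ 3 := by
  have : z - Complex.I * ((1 : ℝ) : ℂ) ^ 2
      - Complex.I * v * (x : ℂ) * ((1 : ℝ) : ℂ)
      + (Complex.I * v + Complex.I * (Complex.I * v) ^ 2) / 2 * (x : ℂ) ^ 2
      = z - Complex.I * (1 + v * x + (v ^ 2 - v) / 2 * x ^ 2) := by
    push_cast
    linear_combination (Complex.I * v ^ 2 / 2 * x ^ 2) * Complex.I_sq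
  rw [diskSite, Set.mem_ofPred_eq, this, div_one]

/-- The square of `1 + v x + (v² - v) / 2 x² + k x³` is `1 + x (2 v + x (2 v² - v + x m))` with
`m` this value. -/
def squareTail {K : Type*} [Field K] (x v k : K) : K :=
  v * (v ^ 2 - v) + 2 * k + x * (((v ^ 2 - v) / 2) ^ 2 + 2 * v * k) + x ^ 2 * ((v ^ 2 - v) * k)
    + x ^ 3 * k ^ 2

theorem sq_eq_squareTail {K : Type*} [Field K] [CharZero K] (x v k : K) :
    (1 + v * x + (v ^ 2 - v) / 2 * x ^ 2 + k * x ^ 3) ^ 2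
      = 1 + x * (2 * v + x * (2 * v ^ 2 - v + x * squareTail x v k)) := by
  unfold squareTail
  field_simp
  ring

/-- For real `v` the polynomial is real on the imaginary axis, so opposite signs at the two ends of
the vertical diameter of the disk give a root. -/
theorem exists_isRoot_mem_diskSite_of_sign {v : ℝ} (hv : v ^ 4 - 8 * v ^ 2 + 12 * v - 4 = 0)
    {x : ℝ} (hx0 : x ≠ 0) {h : ℝ → ℝ}
    (hh : ∀ m, h m = valueLead v m + (x * valueNext v m - x ^ 2 * valueTail x v m))
    (hsign : h (squareTail x v (-51)) * h (squareTail x v 51) < 0) :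
    ∃ z ∈ diskSite (Complex.I * v) x 1, (transformedPoly x 1).IsRoot z := by
  let f : ℝ → ℝ := fun k => charForm x (-(1 + v * x + (v ^ 2 - v) / 2 * x ^ 2 + k * x ^ 3) ^ 2)
  have hf : Continuous f := (continuous_charForm x).comp (by fun_prop)
  have key : ∀ k, f k = x ^ 6 * h (squareTail x v k) := by
    intro k
    simp only [f]
    rw [sq_eq_squareTail, charForm_expansion hv, hh]
    ring
  have hpos : 0 < x ^ 12 := by positivity
  obtain ⟨k, hk1, hk2, hk⟩ := exists_zero_of_mul_neg hf (a := -51) (b := 51) (by norm_num) (by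
    rw [key, key]
    have := mul_neg_of_pos_of_neg hpos hsign
    linarith)
  refine ⟨Complex.I * (1 + v * x + ((v : ℂ) ^ 2 - v) / 2 * x ^ 2 + k * x ^ 3),
    mem_diskSite_I_mul_iff.2 ?_, ?_⟩
  · rw [← mul_sub, add_sub_cancel_left, norm_mul, Complex.norm_I, one_mul, norm_mul, norm_pow,
      Complex.norm_real, Complex.norm_real, Real.norm_eq_abs, Real.norm_eq_abs]
    have h3 : 0 < |x| ^ 3 := by positivity
    have := abs_lt.2 ⟨hk1, hk2⟩
    gcongr
  · have := isRoot_I_mul_ofReal_iff.2 hk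
    push_cast at this
    exact this

theorem abs_squareTail_sub_le {x v k : ℝ} (hx : |x| ≤ 1 / 97) (hv : |v| ≤ 3.44)
    (hk : |k| ≤ 51) : |squareTail x v k - (2 * k + v * (v ^ 2 - v))| ≤ 4.5 := by
  rw [← Real.norm_eq_abs] at *
  have e : squareTail x v k - (2 * k + v * (v ^ 2 - v))
      = x * (v ^ 2 - v) ^ 2 * 4⁻¹ + x * (2 * v * k) + x ^ 2 * ((v ^ 2 - v) * k)
        + x ^ 3 * k ^ 2 := by
    unfold squareTail
    ring
  have h4 : ‖(4 : ℝ)⁻¹‖ ≤ 1 / 4 := by norm_num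
  rw [e]
  apply le_trans
  · repeat' first
      | exact hx
      | exact hv
      | exact hk
      | exact h4
      | exact (RCLike.norm_ofNat _).le
      | with_reducible apply norm_add_le_of_le
      | with_reducible apply norm_sub_le_of_le
      | with_reducible apply norm_mul_le_of_le
      | with_reducible apply norm_pow_le_of_le
  · norm_num

/-- Here the term `-m * derivLead v` of the leading coefficient, with `m` close to `±102`, outweighs
everything else. -/
theorem exists_isRoot_mem_diskSite_upper {v : ℝ} (hv : v ^ 4 - 8 * v ^ 2 + 12 * v - 4 = 0)
    (hv1 : 0.4863801 < v) (hv2 : v < 0.4863802) {x : ℝ} (hx : |x| ≤ 1 / 97) (hx0 : x ≠ 0) :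
    ∃ z ∈ diskSite (Complex.I * v) x 1, (transformedPoly x 1).IsRoot z := by
  have hx' : ‖x‖ ≤ 1 / 97 := hx
  have hv' : ‖v‖ ≤ 0.4863802 := abs_le.2 ⟨by linarith, hv2.le⟩
  have hrest : ∀ m : ℝ, ‖m‖ ≤ 107 →
      ‖x * valueNext v m - x ^ 2 * valueTail x v m‖ ≤ 5000 := by
    intro m hm
    unfold valueNext valueTail
    apply le_trans
    · repeat' first
        | exact hx'
        | exact hv'
        | exact hm
        | exact (RCLike.norm_ofNat _).le
        | with_reducible apply norm_add_le_of_le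
        | with_reducible apply norm_sub_le_of_le
        | with_reducible apply norm_mul_le_of_le
        | with_reducible apply norm_pow_le_of_le
    · norm_num
  have hsq1 : 0.2365 < v ^ 2 := by nlinarith
  have hsq2 : v ^ 2 < 0.2366 := by nlinarith
  have hcu1 : 0.115 < v ^ 3 := by nlinarith
  have hcu2 : v ^ 3 < 0.1151 := by nlinarith
  have hd : 74 < 192 - 256 * v + 64 * v ^ 3 := by linarith
  have hm₁ := abs_le.1 (abs_squareTail_sub_le (v := v) (k := 51) hx
    (by rw [abs_le]; constructor <;> linarith) (by norm_num))
  have hm₂ := abs_le.1 (abs_squareTail_sub_le (v := v) (k := -51) hx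
    (by rw [abs_le]; constructor <;> linarith) (by norm_num))
  refine exists_isRoot_mem_diskSite_of_sign hv hx0 (fun m => rfl) ?_
  set m₁ := squareTail x v 51
  set m₂ := squareTail x v (-51)
  have r₁ := abs_le.1 (hrest m₁ (abs_le.2 ⟨by linarith, by linarith⟩))
  have r₂ := abs_le.1 (hrest m₂ (abs_le.2 ⟨by linarith, by linarith⟩))
  have p₁ : 97 * 74 ≤ m₁ * (192 - 256 * v + 64 * v ^ 3) :=
    mul_le_mul (by linarith) hd.le (by norm_num) (by linarith)
  have p₂ : 97 * 74 ≤ -m₂ * (192 - 256 * v + 64 * v ^ 3) :=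
    mul_le_mul (by linarith) hd.le (by norm_num) (by linarith)
  refine mul_neg_of_pos_of_neg ?_ ?_ <;> unfold valueLead <;> linarith

/-- The correction of order `x³` to the center is here about `34 x³`, so the two ends of the diameter
lie at quite different distances from the root (`m` near `50` and near `-155`), and the tail is
bounded separately at each. -/
theorem exists_isRoot_mem_diskSite_lower {v : ℝ} (hv : v ^ 4 - 8 * v ^ 2 + 12 * v - 4 = 0)
    (hv1 : -3.4391092 < v) (hv2 : v < -3.439109) {x : ℝ} (hx : |x| ≤ 1 / 97) (hx0 : x ≠ 0) :
    ∃ z ∈ diskSite (Complex.I * v) x 1, (transformedPoly x 1).IsRoot z := by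
  have hx' : ‖x‖ ≤ 1 / 97 := hx
  have hv' : ‖v‖ ≤ 3.4391092 := abs_le.2 ⟨hv1.le, by linarith⟩
  have hrest₁ : ∀ m : ℝ, ‖m‖ ≤ 55 →
      ‖x * valueNext v m - x ^ 2 * valueTail x v m‖ ≤ 35000 := by
    intro m hm
    unfold valueNext valueTail
    apply le_trans
    · repeat' first
        | exact hx'
        | exact hv'
        | exact hm
        | exact (RCLike.norm_ofNat _).le
        | with_reducible apply norm_add_le_of_le
        | with_reducible apply norm_sub_le_of_le
        | with_reducible apply norm_mul_le_of_le
        | with_reducible apply norm_pow_le_of_le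
    · norm_num
  have hrest₂ : ∀ m : ℝ, ‖m‖ ≤ 160 →
      ‖x * valueNext v m - x ^ 2 * valueTail x v m‖ ≤ 100000 := by
    intro m hm
    unfold valueNext valueTail
    apply le_trans
    · repeat' first
        | exact hx'
        | exact hv'
        | exact hm
        | exact (RCLike.norm_ofNat _).le
        | with_reducible apply norm_add_le_of_le
        | with_reducible apply norm_sub_le_of_le
        | with_reducible apply norm_mul_le_of_le
        | with_reducible apply norm_pow_le_of_le
    · norm_num
  have hsq1 : 11.827 < v ^ 2 := by nlinarith
  have hsq2 : v ^ 2 < 11.828 := by nlinarith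
  have hcu1 : -40.68 < v ^ 3 := by nlinarith
  have hcu2 : v ^ 3 < -40.67 := by nlinarith
  have hd : 1530 < -(192 - 256 * v + 64 * v ^ 3) := by linarith
  have hm₁ := abs_le.1 (abs_squareTail_sub_le (v := v) (k := 51) hx
    (by rw [abs_le]; constructor <;> linarith) (by norm_num))
  have hm₂ := abs_le.1 (abs_squareTail_sub_le (v := v) (k := -51) hx
    (by rw [abs_le]; constructor <;> linarith) (by norm_num))
  refine exists_isRoot_mem_diskSite_of_sign hv hx0 (fun m => rfl) ?_
  set m₁ := squareTail x v 51
  set m₂ := squareTail x v (-51)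
  have r₁ := abs_le.1 (hrest₁ m₁ (abs_le.2 ⟨by linarith, by linarith⟩))
  have r₂ := abs_le.1 (hrest₂ m₂ (abs_le.2 ⟨by linarith, by linarith⟩))
  have p₁ : 44 * 1530 ≤ m₁ * -(192 - 256 * v + 64 * v ^ 3) :=
    mul_le_mul (by linarith) hd.le (by norm_num) (by linarith)
  have p₂ : 149 * 1530 ≤ -m₂ * -(192 - 256 * v + 64 * v ^ 3) :=
    mul_le_mul (by linarith) hd.le (by norm_num) (by linarith)
  refine mul_neg_of_neg_of_pos ?_ ?_ <;> unfold valueLead <;> linarith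

/-! ### The roots off the axes -/

theorem norm_le_of_re_sq_add_im_sq_le {z : ℂ} {B : ℝ} (hB : 0 ≤ B)
    (h : z.re ^ 2 + z.im ^ 2 ≤ B ^ 2) : ‖z‖ ≤ B := by
  refine le_of_sq_le_sq ?_ hB
  rw [Complex.sq_norm, Complex.normSq_apply]
  linarith

theorem le_norm_of_le_re_sq_add_im_sq {z : ℂ} {B : ℝ} (h : B ^ 2 ≤ z.re ^ 2 + z.im ^ 2) :
    B ≤ ‖z‖ := by
  refine le_of_sq_le_sq ?_ (norm_nonneg z)
  rw [Complex.sq_norm, Complex.normSq_apply]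
  linarith

/-- The root of the quartic of `v` in the fourth quadrant, to five decimals. -/
noncomputable def approxV : ℂ := ⟨1.47636, -0.46008⟩

theorem norm_approxV_le : ‖approxV‖ ≤ 1.5464 := by
  apply norm_le_of_re_sq_add_im_sq_le <;> norm_num [approxV]

theorem norm_cube_sub_sq_approxV_le : ‖approxV ^ 3 - approxV ^ 2‖ ≤ 1.6 := by
  apply norm_le_of_re_sq_add_im_sq_le (by norm_num)
  simp only [approxV, pow_succ, pow_zero, one_mul, Complex.mul_re, Complex.mul_im, Complex.sub_re,
    Complex.sub_im]
  norm_num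

theorem norm_valueLead_approxV_le : ‖valueLead approxV (approxV ^ 3 - approxV ^ 2)‖ ≤ 24 := by
  apply norm_le_of_re_sq_add_im_sq_le (by norm_num)
  simp only [valueLead, approxV, pow_succ, pow_zero, one_mul, Complex.mul_re, Complex.mul_im,
      Complex.add_re, Complex.add_im, Complex.sub_re, Complex.sub_im, Complex.re_ofNat,
      Complex.im_ofNat]
  norm_num

theorem norm_valueNext_approxV_le : ‖valueNext approxV (approxV ^ 3 - approxV ^ 2)‖ ≤ 250 := by
  apply norm_le_of_re_sq_add_im_sq_le (by norm_num)
  simp only [valueNext, approxV, pow_succ, pow_zero, one_mul, Complex.mul_re, Complex.mul_im,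
      Complex.add_re, Complex.add_im, Complex.sub_re, Complex.sub_im, Complex.re_ofNat,
      Complex.im_ofNat]
  norm_num

theorem norm_derivLead_approxV_le : ‖derivLead approxV‖ ≤ 80 := by
  apply norm_le_of_re_sq_add_im_sq_le (by norm_num)
  simp only [derivLead, approxV, pow_succ, pow_zero, one_mul, Complex.mul_re, Complex.mul_im,
      Complex.add_re, Complex.add_im, Complex.sub_re, Complex.sub_im, Complex.re_ofNat,
      Complex.im_ofNat]
  norm_num

theorem norm_derivNext_approxV_le : ‖derivNext approxV‖ ≤ 700 := by
  apply norm_le_of_re_sq_add_im_sq_le (by norm_num)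
  simp only [derivNext, approxV, pow_succ, pow_zero, one_mul, Complex.mul_re, Complex.mul_im,
      Complex.add_re, Complex.add_im, Complex.sub_re, Complex.sub_im, Complex.re_ofNat,
      Complex.im_ofNat]
  norm_num

theorem le_norm_derivLead_approxV : 79 ≤ ‖derivLead approxV‖ := by
  apply le_norm_of_le_re_sq_add_im_sq
  simp only [derivLead, approxV, pow_succ, pow_zero, one_mul, Complex.mul_re, Complex.mul_im,
      Complex.add_re, Complex.add_im, Complex.sub_re, Complex.sub_im, Complex.re_ofNat,
      Complex.im_ofNat]
  norm_num

/-- The tail for `k = 0` is `v³ - v²` up to a term of order `x`. -/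
theorem norm_squareTail_zero_sub_le {x v : ℂ} (hx : ‖x‖ ≤ 1 / 97)
    (hv : ‖v - approxV‖ ≤ 1 / 100000) (hv' : ‖v‖ ≤ 1.5465) :
    ‖squareTail x v 0 - (approxV ^ 3 - approxV ^ 2)‖ ≤ 0.05 := by
  have hc := norm_approxV_le
  have h4 : ‖(4 : ℂ)⁻¹‖ ≤ 1 / 4 := by norm_num
  have e : squareTail x v 0 - (approxV ^ 3 - approxV ^ 2)
      = (v - approxV) * (v ^ 2 + v * approxV + approxV ^ 2 - (v + approxV))
        + x * (v ^ 2 - v) ^ 2 * 4⁻¹ := by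
    unfold squareTail
    ring
  rw [e]
  apply le_trans
  · repeat' first
      | with_reducible exact hx
      | with_reducible exact hv
      | with_reducible exact hv'
      | with_reducible exact hc
      | with_reducible exact h4
      | exact (RCLike.norm_ofNat _).le
      | with_reducible apply norm_add_le_of_le
      | with_reducible apply norm_sub_le_of_le
      | with_reducible apply norm_mul_le_of_le
      | with_reducible apply norm_pow_le_of_le
  · norm_num

/-- The value of the expanded form at the center of the disk of the complex root. -/
theorem norm_value_le {x v : ℂ} (hx : ‖x‖ ≤ 1 / 97) (hv : ‖v - approxV‖ ≤ 1 / 100000) :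
    ‖valueLead v (squareTail x v 0) + x * valueNext v (squareTail x v 0)
      - x ^ 2 * valueTail x v (squareTail x v 0)‖ ≤ 300 := by
  have hc := norm_approxV_le
  have hv' : ‖v‖ ≤ 1.5465 := by
    have := norm_le_norm_add_norm_sub' v approxV
    linarith
  have hμ := norm_squareTail_zero_sub_le hx hv hv'
  have hm : ‖squareTail x v 0‖ ≤ 1.65 := by
    have := norm_le_norm_add_norm_sub' (squareTail x v 0) (approxV ^ 3 - approxV ^ 2)
    have := norm_cube_sub_sq_approxV_le
    linarith
  generalize squareTail x v 0 = m at hμ hm ⊢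
  have n₀ := norm_valueLead_approxV_le
  have n₁ := norm_valueNext_approxV_le
  have n₂ := norm_derivLead_approxV_le
  have n₃ := norm_derivNext_approxV_le
  have e₀ : valueLead v m = valueLead approxV (approxV ^ 3 - approxV ^ 2)
      + (v - approxV) * (896 - 896 * (v + approxV)
        + 256 * (v ^ 2 + v * approxV + approxV ^ 2))
      - m * ((v - approxV) * (64 * (v ^ 2 + v * approxV + approxV ^ 2) - 256))
      - (m - (approxV ^ 3 - approxV ^ 2)) * derivLead approxV := by
    unfold valueLead derivLead
    ring
  have e₁ : valueNext v m = valueNext approxV (approxV ^ 3 - approxV ^ 2)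
      + (v - approxV) * (39072 * (v + approxV) - 43936
        - 11520 * (v ^ 2 + v * approxV + approxV ^ 2))
      - m * ((v - approxV) * (768 * (v + approxV)
        + 224 * (v ^ 2 + v * approxV + approxV ^ 2) - 2624))
      - (m - (approxV ^ 3 - approxV ^ 2)) * derivNext approxV := by
    unfold valueNext derivNext
    ring
  -- The two leading coefficients would be overestimated by the triangle inequality: they are
  -- evaluated at `approxV`, and only their variation is estimated.
  rw [e₀, e₁]
  generalize valueLead approxV (approxV ^ 3 - approxV ^ 2) = w₀ at n₀
  generalize valueNext approxV (approxV ^ 3 - approxV ^ 2) = w₁ at n₁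
  generalize derivLead approxV = w₂ at n₂
  generalize derivNext approxV = w₃ at n₃
  unfold valueTail
  apply le_trans
  · repeat' first
      | with_reducible exact hx
      | with_reducible exact hv
      | with_reducible exact hv'
      | with_reducible exact hμ
      | with_reducible exact hm
      | with_reducible exact hc
      | with_reducible exact n₀
      | with_reducible exact n₁
      | with_reducible exact n₂
      | with_reducible exact n₃
      | exact (RCLike.norm_ofNat _).le
      | with_reducible apply norm_add_le_of_le
      | with_reducible apply norm_sub_le_of_le
      | with_reducible apply norm_mul_le_of_le
      | with_reducible apply norm_pow_le_of_le
  · norm_num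

/-- The derivative of the expanded form at the center of the disk of the complex root. -/
theorem le_norm_deriv {x v : ℂ} (hx : ‖x‖ ≤ 1 / 97) (hv : ‖v - approxV‖ ≤ 1 / 100000) :
    60 ≤ ‖derivLead v + x * derivNext v + x ^ 2 * derivTail x v (squareTail x v 0)‖ := by
  have hc := norm_approxV_le
  have hv' : ‖v‖ ≤ 1.5465 := by
    have := norm_le_norm_add_norm_sub' v approxV
    linarith
  have hμ := norm_squareTail_zero_sub_le hx hv hv'
  have hm : ‖squareTail x v 0‖ ≤ 1.65 := by
    have := norm_le_norm_add_norm_sub' (squareTail x v 0) (approxV ^ 3 - approxV ^ 2)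
    have := norm_cube_sub_sq_approxV_le
    linarith
  generalize squareTail x v 0 = m at hμ hm ⊢
  have n₃ := norm_derivNext_approxV_le
  have e : derivLead approxV - (derivLead v + x * derivNext v + x ^ 2 * derivTail x v m)
      = (v - approxV) * (256 - 64 * (v ^ 2 + v * approxV + approxV ^ 2))
      - x * (derivNext approxV + (v - approxV) * (768 * (v + approxV)
        + 224 * (v ^ 2 + v * approxV + approxV ^ 2) - 2624))
      - x ^ 2 * derivTail x v m := by
    unfold derivLead derivNext
    ring
  have hdiff : ‖derivLead approxV - (derivLead v + x * derivNext v + x ^ 2 * derivTail x v m)‖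
      ≤ 19 := by
    rw [e]
    generalize derivNext approxV = w₃ at n₃
    unfold derivTail
    apply le_trans
    · repeat' first
        | with_reducible exact hx
        | with_reducible exact hv
        | with_reducible exact hv'
        | with_reducible exact hm
        | with_reducible exact hc
        | with_reducible exact n₃
        | exact (RCLike.norm_ofNat _).le
        | with_reducible apply norm_add_le_of_le
        | with_reducible apply norm_sub_le_of_le
        | with_reducible apply norm_mul_le_of_le
        | with_reducible apply norm_pow_le_of_le
    · norm_num
  have h1 := le_norm_derivLead_approxV
  have h2 := norm_le_norm_add_norm_sub' (derivLead approxV)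
    (derivLead v + x * derivNext v + x ^ 2 * derivTail x v m)
  linarith

/-- At the center the value is at most `300 |x|⁶` and the derivative at least `2 * 0.9 * 60 |x|³`, and
`10 * 300 < 51 * 2 * 0.9 * 60`. -/
theorem exists_isRoot_mem_diskSite_of_near_approxV {v : ℂ}
    (hv : v ^ 4 - 8 * v ^ 2 + 12 * v - 4 = 0) (hva : ‖v - approxV‖ ≤ 1 / 100000) {x : ℝ}
    (hx : |x| ≤ 1 / 97) (hx0 : x ≠ 0) :
    ∃ z ∈ diskSite (Complex.I * v) x 1, (transformedPoly x 1).IsRoot z := by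
  have hx' : ‖(x : ℂ)‖ ≤ 1 / 97 := by rwa [Complex.norm_real]
  have hv' : ‖v‖ ≤ 1.5465 := by
    have h1 := norm_le_norm_add_norm_sub' v approxV
    have h2 := norm_approxV_le
    linarith
  set σ : ℂ := 1 + v * x + (v ^ 2 - v) / 2 * x ^ 2 with hσ
  have hsq : (Complex.I * σ) ^ 2
      = -(1 + x * (2 * v + x * (2 * v ^ 2 - v + x * squareTail (x : ℂ) v 0))) := by
    rw [← sq_eq_squareTail, mul_pow, Complex.I_sq, hσ]
    ring
  have hσ1 : 0.9 ≤ ‖σ‖ := by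
    have h1 : ‖1 - σ‖ ≤ 0.1 := by
      have h2 : ‖(2 : ℂ)⁻¹‖ ≤ 1 / 2 := by norm_num
      have e : 1 - σ = -(v * x + (v ^ 2 - v) * 2⁻¹ * x ^ 2) := by
        rw [hσ]
        ring
      rw [e, norm_neg]
      apply le_trans
      · repeat' first
          | with_reducible exact hx'
          | with_reducible exact hv'
          | with_reducible exact h2
          | exact (RCLike.norm_ofNat _).le
          | with_reducible apply norm_add_le_of_le
          | with_reducible apply norm_sub_le_of_le
          | with_reducible apply norm_mul_le_of_le
          | with_reducible apply norm_pow_le_of_le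
      · norm_num
    have h2 := norm_le_norm_add_norm_sub' 1 σ
    rw [norm_one] at h2
    linarith
  have hval := norm_value_le hx' hva
  have hder := le_norm_deriv hx' hva
  have h3 : 0 < |x| ^ 3 := by positivity
  obtain ⟨z, hz, hzn⟩ := exists_isRoot_near (natDegree_transformedPoly x 1).le
    (c := Complex.I * σ) (r := 51 * |x| ^ 3) (by
      rw [eval_transformedPoly, eval_derivative_transformedPoly, hsq, charForm_expansion hv,
        charFormDeriv_expansion hv]
      simp only [norm_mul, norm_pow, Complex.norm_I, RCLike.norm_ofNat, Complex.norm_real,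
        Real.norm_eq_abs]
      set A := ‖valueLead v (squareTail (x : ℂ) v 0) + x * valueNext v (squareTail (x : ℂ) v 0)
        - x ^ 2 * valueTail (x : ℂ) v (squareTail (x : ℂ) v 0)‖
      set B := ‖derivLead v + x * derivNext v
        + x ^ 2 * derivTail (x : ℂ) v (squareTail (x : ℂ) v 0)‖
      have hB : 0.9 * 60 ≤ ‖σ‖ * B := mul_le_mul hσ1 hder (by norm_num) (norm_nonneg _)
      have h6 : 0 < |x| ^ 6 := by positivity
      have hlt : 10 * A < 102 * (‖σ‖ * B) := by linarith
      calc ((10 : ℕ) : ℝ) * (|x| ^ 6 * A) = |x| ^ 6 * (10 * A) := by push_cast; ring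
        _ < |x| ^ 6 * (102 * (‖σ‖ * B)) := by gcongr
        _ = _ := by ring)
  exact ⟨z, mem_diskSite_I_mul_iff.2 hzn, hz⟩

/-! ### The roots of the quartic -/

theorem eval_centerQuartic_I_mul (v : ℂ) :
    centerQuartic.eval (Complex.I * v) = v ^ 4 - 8 * v ^ 2 + 12 * v - 4 := by
  simp only [centerQuartic, eval_add, eval_sub, eval_mul, eval_pow, eval_X, eval_C]
  linear_combination (v ^ 4 * (Complex.I ^ 2 - 1) + 8 * v ^ 2 - 12 * v) * Complex.I_sq

theorem exists_quartic_root_upper : ∃ v : ℝ, v ^ 4 - 8 * v ^ 2 + 12 * v - 4 = 0 ∧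
    |v - 0.4863801704| ≤ 5 / 10 ^ 10 := by
  obtain ⟨v, h1, h2, hv⟩ := exists_zero_of_mul_neg
    (f := fun v : ℝ => v ^ 4 - 8 * v ^ 2 + 12 * v - 4) (by fun_prop)
    (a := 0.4863801704 - 5 / 10 ^ 10) (b := 0.4863801704 + 5 / 10 ^ 10) (by norm_num)
    (by norm_num)
  exact ⟨v, hv, abs_le.2 ⟨by linarith, by linarith⟩⟩

theorem exists_quartic_root_lower : ∃ v : ℝ, v ^ 4 - 8 * v ^ 2 + 12 * v - 4 = 0 ∧
    |v - -3.439109107| ≤ 9 / 10 ^ 10 := by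
  obtain ⟨v, h1, h2, hv⟩ := exists_zero_of_mul_neg
    (f := fun v : ℝ => v ^ 4 - 8 * v ^ 2 + 12 * v - 4) (by fun_prop)
    (a := -3.439109107 - 9 / 10 ^ 10) (b := -3.439109107 + 9 / 10 ^ 10) (by norm_num)
    (by norm_num)
  exact ⟨v, hv, abs_le.2 ⟨by linarith, by linarith⟩⟩

theorem exists_quartic_root_complex : ∃ v : ℂ, v ^ 4 - 8 * v ^ 2 + 12 * v - 4 = 0 ∧
    ‖v - ⟨1.476364468, -0.4600767354⟩‖ < 1 / 10 ^ 9 := by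
  let P : ℂ[X] := X ^ 4 - C 8 * X ^ 2 + C 12 * X - C 4
  have hdeg : P.natDegree ≤ 4 := by
    simp only [P]
    compute_degree
  -- The prescribed ten digits are too coarse a starting point for the factor `4` of
  -- `exists_isRoot_near`, so the root is approximated to more digits.
  let c : ℂ := ⟨1.476364468207593, -0.46007673544378⟩
  have he : P.eval c = c ^ 4 - 8 * c ^ 2 + 12 * c - 4 := by
    simp [P]
  have hd : P.derivative.eval c = 4 * c ^ 3 - 16 * c + 12 := by
    simp only [P, derivative_add, derivative_sub, derivative_mul, derivative_X_pow, derivative_C,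
      derivative_X, eval_add, eval_sub, eval_mul, eval_pow, eval_X, eval_C, eval_zero, eval_one]
    push_cast
    ring
  have h1 : ‖c ^ 4 - 8 * c ^ 2 + 12 * c - 4‖ ≤ 1 / 10 ^ 11 := by
    apply norm_le_of_re_sq_add_im_sq_le (by norm_num)
    simp only [c, pow_succ, pow_zero, one_mul, Complex.mul_re, Complex.mul_im, Complex.add_re,
      Complex.add_im, Complex.sub_re, Complex.sub_im, Complex.re_ofNat, Complex.im_ofNat]
    norm_num
  have h2 : 1 ≤ ‖4 * c ^ 3 - 16 * c + 12‖ := by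
    apply le_norm_of_le_re_sq_add_im_sq
    simp only [c, pow_succ, pow_zero, one_mul, Complex.mul_re, Complex.mul_im, Complex.add_re,
      Complex.add_im, Complex.sub_re, Complex.sub_im, Complex.re_ofNat, Complex.im_ofNat]
    norm_num
  obtain ⟨v, hv, hvc⟩ := exists_isRoot_near hdeg (c := c) (r := 1 / 10 ^ 10) (by
    rw [he, hd]
    push_cast
    linarith)
  refine ⟨v, by simpa [P] using hv, ?_⟩
  have h3 : ‖c - ⟨1.476364468, -0.4600767354⟩‖ ≤ 8 / 10 ^ 10 := by
    apply norm_le_of_re_sq_add_im_sq_le (by norm_num)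
    simp only [c, Complex.sub_re, Complex.sub_im]
    norm_num
  have := norm_sub_le_norm_sub_add_norm_sub v c ⟨1.476364468, -0.4600767354⟩
  linarith

theorem centerQuartic_roots {u₂ u₃ u₄ u₅ : ℂ} (h₂ : centerQuartic.eval u₂ = 0)
    (h₃ : centerQuartic.eval u₃ = 0) (h₄ : centerQuartic.eval u₄ = 0)
    (h₅ : centerQuartic.eval u₅ = 0) (h₂₃ : u₂ ≠ u₃) (h₂₄ : u₂ ≠ u₄) (h₂₅ : u₂ ≠ u₅)
    (h₃₄ : u₃ ≠ u₄) (h₃₅ : u₃ ≠ u₅) (h₄₅ : u₄ ≠ u₅) :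
    centerQuartic.roots = {u₂, u₃, u₄, u₅} := by
  have hdeg : centerQuartic.natDegree = 4 := by
    unfold centerQuartic
    compute_degree!
  have h0 : centerQuartic ≠ 0 := by
    intro h
    simp [h] at hdeg
  symm
  apply Multiset.eq_of_le_of_card_le
  · rw [Multiset.le_iff_subset (by simp [h₂₃, h₂₄, h₂₅, h₃₄, h₃₅, h₄₅])]
    intro z hz
    rw [mem_roots h0, IsRoot.def]
    simp only [Multiset.insert_eq_cons, Multiset.mem_cons, Multiset.mem_singleton] at hz
    rcases hz with rfl | rfl | rfl | rfl <;> assumption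
  · simpa [hdeg] using card_roots' centerQuartic

/-! ### The sites -/

theorem norm_sub_center_lt {u z : ℂ} {x : ℝ} (h : z ∈ diskSite u x 1) :
    ‖z - (Complex.I + u * x - (u + Complex.I * u ^ 2) / 2 * x ^ 2)‖ < 51 * |x| ^ 3 := by
  rw [diskSite, Set.mem_ofPred_eq, div_one] at h
  convert h using 2
  push_cast
  ring

theorem norm_centerCoeff_le {u : ℂ} (hu : ‖u‖ ≤ 3.44) :
    ‖(u + Complex.I * u ^ 2) / 2‖ ≤ 7.64 := by
  have h1 : ‖u + Complex.I * u ^ 2‖ ≤ 3.44 + 3.44 ^ 2 := by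
    refine norm_add_le_of_le hu ?_
    rw [norm_mul, Complex.norm_I, one_mul]
    exact norm_pow_le_of_le hu 2
  rw [norm_div, RCLike.norm_ofNat, div_le_iff₀ (by norm_num)]
  linarith

/-- The centers of two disks are `|u - u'| |x| - O(x²)` apart, their radii are of order `|x|³`. -/
theorem disjoint_diskSite {u u' : ℂ} {x : ℝ} (hx : |x| ≤ 1 / 97) (hx0 : x ≠ 0)
    (hu : ‖u‖ ≤ 3.44) (hu' : ‖u'‖ ≤ 3.44) (huu' : 0.9 ≤ ‖u - u'‖) :
    Disjoint (diskSite u x 1) (diskSite u' x 1) := by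
  rw [Set.disjoint_left]
  intro z hz hz'
  have h1 := norm_sub_center_lt hz
  have h2 := norm_sub_center_lt hz'
  have hx' : 0 < |x| := abs_pos.2 hx0
  have ha : ‖((u + Complex.I * u ^ 2) / 2 - (u' + Complex.I * u' ^ 2) / 2) * (x : ℂ) ^ 2‖
      ≤ 15.28 * |x| ^ 2 := by
    rw [norm_mul, norm_pow, Complex.norm_real, Real.norm_eq_abs]
    have := norm_sub_le_of_le (norm_centerCoeff_le hu) (norm_centerCoeff_le hu')
    gcongr
    linarith
  have hb : 0.9 * |x| ≤ ‖(u - u') * (x : ℂ)‖ := by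
    rw [norm_mul, Complex.norm_real, Real.norm_eq_abs]
    gcongr
  have e : (u - u') * (x : ℂ)
      = (z - (Complex.I + u' * x - (u' + Complex.I * u' ^ 2) / 2 * x ^ 2))
        - (z - (Complex.I + u * x - (u + Complex.I * u ^ 2) / 2 * x ^ 2))
        + ((u + Complex.I * u ^ 2) / 2 - (u' + Complex.I * u' ^ 2) / 2) * (x : ℂ) ^ 2 := by
    ring
  rw [e] at hb
  have h3 := hb.trans (norm_add_le_of_le (norm_sub_le_of_le h2.le h1.le) ha)
  have h4 : |x| ^ 2 ≤ |x| * (1 / 97) := by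
    rw [sq]
    gcongr
  have h5 : |x| ^ 3 ≤ |x| * (1 / 97) ^ 2 := by
    rw [pow_succ, mul_comm]
    gcongr
  linarith

theorem im_pos_of_mem_diskSite {u z : ℂ} {x : ℝ} (hx : |x| ≤ 1 / 97) (hu : ‖u‖ ≤ 3.44)
    (hz : z ∈ diskSite u x 1) : 0 < z.im := by
  have h1 := norm_sub_center_lt hz
  have hx' : ‖(x : ℂ)‖ ≤ 1 / 97 := by rwa [Complex.norm_real]
  have h2 : ‖u * x - (u + Complex.I * u ^ 2) / 2 * x ^ 2‖ ≤ 3.44 * (1 / 97) + 7.64 * (1 / 97) ^ 2 :=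
    norm_sub_le_of_le (norm_mul_le_of_le hu hx')
      (norm_mul_le_of_le (norm_centerCoeff_le hu) (norm_pow_le_of_le hx' 2))
  have h3 : 51 * |x| ^ 3 ≤ 51 * (1 / 97) ^ 3 := by gcongr
  have h4 := norm_add_le_of_le h1.le h2
  have e : z - (Complex.I + u * x - (u + Complex.I * u ^ 2) / 2 * x ^ 2)
      + (u * x - (u + Complex.I * u ^ 2) / 2 * x ^ 2) = z - Complex.I := by
    ring
  rw [e] at h4
  have h5 := (abs_le.1 ((Complex.abs_im_le_norm (z - Complex.I)).trans h4)).1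
  rw [Complex.sub_im, Complex.I_im] at h5
  norm_num at h5 h3
  linarith

theorem realSite_im_re {x : ℝ} (hx : |x| ≤ 1 / 97) {z : ℂ} (hz : z ∈ realSite x 1) :
    z.im = 0 ∧ 0 < z.re := by
  obtain ⟨t, rfl, h⟩ := hz
  refine ⟨Complex.ofReal_im t, ?_⟩
  rw [Complex.ofReal_re]
  obtain ⟨hx1, hx2⟩ := abs_le.1 hx
  have h3 : |x| ^ 3 ≤ (1 / 97) ^ 3 := by gcongr
  rcases h with ⟨h0, h1, -⟩ | ⟨h0, h1, -⟩
  · norm_num at h1 h3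
    nlinarith
  · nlinarith

theorem isSelected_of_im_pos {z : ℂ} (h : 0 < z.im) : IsSelected z :=
  ⟨fun h0 => absurd h0 h.ne', fun _ => h⟩

theorem isSelected_of_mem_realSite {x : ℝ} (hx : |x| ≤ 1 / 97) {z : ℂ} (hz : z ∈ realSite x 1) :
    IsSelected z :=
  ⟨fun _ => (realSite_im_re hx hz).2, fun h => absurd (realSite_im_re hx hz).1 h⟩

theorem IsSelected.scale {q : ℝ} (hq : 0 < q) {s : ℂ} (hs : IsSelected s) :
    IsSelected ((q : ℂ) ^ 2 * s) := by
  have hq2 : 0 < q ^ 2 := by positivity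
  have him : ((q : ℂ) ^ 2 * s).im = q ^ 2 * s.im := by
    rw [← Complex.ofReal_pow, Complex.im_ofReal_mul]
  have hre : ((q : ℂ) ^ 2 * s).re = q ^ 2 * s.re := by
    rw [← Complex.ofReal_pow, Complex.re_ofReal_mul]
  refine ⟨fun h => ?_, fun h => ?_⟩
  · rw [him, mul_eq_zero, or_iff_right hq2.ne'] at h
    rw [hre]
    exact mul_pos hq2 (hs.1 h)
  · rw [him] at h ⊢
    exact mul_pos hq2 (hs.2 (right_ne_zero_of_mul h))

theorem scale_mem_diskSite_iff {u s : ℂ} {x q : ℝ} (hq : 0 < q) :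
    (q : ℂ) ^ 2 * s ∈ diskSite u (x * q) q ↔ s ∈ diskSite u x 1 := by
  have e : (q : ℂ) ^ 2 * s - Complex.I * (q : ℂ) ^ 2 - u * ((x * q : ℝ) : ℂ) * (q : ℂ)
      + (u + Complex.I * u ^ 2) / 2 * ((x * q : ℝ) : ℂ) ^ 2
      = (q : ℂ) ^ 2 * (s - Complex.I * ((1 : ℝ) : ℂ) ^ 2 - u * (x : ℂ) * ((1 : ℝ) : ℂ)
        + (u + Complex.I * u ^ 2) / 2 * (x : ℂ) ^ 2) := by
    push_cast
    ring
  have e' : 51 * |x * q| ^ 3 / q = q ^ 2 * (51 * |x| ^ 3 / 1) := by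
    rw [abs_mul, abs_of_pos hq]
    field_simp
  have hq2 : 0 < q ^ 2 := by positivity
  rw [diskSite, diskSite, Set.mem_ofPred_eq, Set.mem_ofPred_eq, e, e', norm_mul, norm_pow,
    Complex.norm_real, Real.norm_of_nonneg hq.le, mul_lt_mul_iff_right₀ hq2]

theorem scale_mem_realSite_iff {s : ℂ} {x q : ℝ} (hq : 0 < q) :
    (q : ℂ) ^ 2 * s ∈ realSite (x * q) q ↔ s ∈ realSite x 1 := by
  have hq2 : 0 < q ^ 2 := by positivity
  have hqc : (q : ℂ) ≠ 0 := Complex.ofReal_ne_zero.2 hq.ne'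
  have e : 74 * |x * q| ^ 3 / q = q ^ 2 * (74 * |x| ^ 3 / 1) := by
    rw [abs_mul, abs_of_pos hq]
    field_simp
  have key : ∀ t : ℝ,
      ((0 < x * q ∧ q ^ 2 + 5 * (x * q) * q + 10 * (x * q) ^ 2 - 74 * |x * q| ^ 3 / q < q ^ 2 * t ∧
        q ^ 2 * t < q ^ 2 + 5 * (x * q) * q + 10 * (x * q) ^ 2) ∨
      (x * q < 0 ∧ q ^ 2 + 5 * (x * q) * q + 10 * (x * q) ^ 2 < q ^ 2 * t ∧
        q ^ 2 * t < q ^ 2 + 5 * (x * q) * q + 10 * (x * q) ^ 2 + 74 * |x * q| ^ 3 / q)) ↔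
      ((0 < x ∧ 1 ^ 2 + 5 * x * 1 + 10 * x ^ 2 - 74 * |x| ^ 3 / 1 < t ∧
        t < 1 ^ 2 + 5 * x * 1 + 10 * x ^ 2) ∨
      (x < 0 ∧ 1 ^ 2 + 5 * x * 1 + 10 * x ^ 2 < t ∧
        t < 1 ^ 2 + 5 * x * 1 + 10 * x ^ 2 + 74 * |x| ^ 3 / 1)) := by
    intro t
    have hneg : x * q < 0 ↔ x < 0 := by
      rw [← not_le, ← not_le, mul_nonneg_iff_of_pos_right hq]
    have e₁ : q ^ 2 + 5 * (x * q) * q + 10 * (x * q) ^ 2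
        = q ^ 2 * (1 ^ 2 + 5 * x * 1 + 10 * x ^ 2) := by
      ring
    rw [e, e₁, ← mul_sub, ← mul_add, mul_lt_mul_iff_right₀ hq2, mul_lt_mul_iff_right₀ hq2,
      mul_lt_mul_iff_right₀ hq2, mul_lt_mul_iff_right₀ hq2, mul_pos_iff_of_pos_right hq, hneg]
  constructor
  · rintro ⟨t, ht, h⟩
    have ht' : t = q ^ 2 * (t / q ^ 2) := by field_simp
    refine ⟨t / q ^ 2, ?_, ?_⟩
    · push_cast
      rw [eq_div_iff (pow_ne_zero 2 hqc), mul_comm, ht]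
    · rw [ht'] at h
      exact (key _).1 h
  · rintro ⟨t, rfl, h⟩
    exact ⟨q ^ 2 * t, by push_cast; rfl, (key t).2 h⟩

/-- Reflection in the imaginary axis maps the disk of `u` to that of `-conj u`. -/
theorem neg_conj_mem_diskSite {v z : ℂ} {x : ℝ} (hz : z ∈ diskSite (Complex.I * v) x 1) :
    -starRingEnd ℂ z ∈ diskSite (Complex.I * starRingEnd ℂ v) x 1 := by
  rw [mem_diskSite_I_mul_iff] at hz ⊢
  rw [← Complex.norm_conj, ← norm_neg] at hz
  have e : -starRingEnd ℂ (z - Complex.I * (1 + v * x + (v ^ 2 - v) / 2 * x ^ 2))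
      = -starRingEnd ℂ z - Complex.I * (1 + starRingEnd ℂ v * x
        + (starRingEnd ℂ v ^ 2 - starRingEnd ℂ v) / 2 * x ^ 2) := by
    simp only [map_add, map_sub, map_mul, map_div₀, map_pow, map_one, Complex.conj_ofNat,
      Complex.conj_ofReal, Complex.conj_I]
    ring
  rwa [e] at hz

/-! ### Location of the ten roots -/

theorem theorem6p1 :
    ∃ u₂ u₃ u₄ u₅ : ℂ,
      -- the four roots of the quartic, named through their approximate values
      centerQuartic.roots = {u₂, u₃, u₄, u₅} ∧
      ‖u₂ - 0.4863801704 * Complex.I‖ < (10 : ℝ) ^ (-9 : ℤ) ∧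
      ‖u₃ - (-3.439109107) * Complex.I‖ < (10 : ℝ) ^ (-9 : ℤ) ∧
      ‖u₄ - (0.4600767354 + 1.476364468 * Complex.I)‖ < (10 : ℝ) ^ (-9 : ℤ) ∧
      ‖u₅ - (-0.4600767354 + 1.476364468 * Complex.I)‖ < (10 : ℝ) ^ (-9 : ℤ) ∧
      ∀ p q : ℝ, 97 * |p| ≤ q → |p| ≠ 0 →
        -- the five sites are pairwise disjoint
        Pairwise (fun i j => Disjoint (site u₂ u₃ u₄ u₅ p q i) (site u₂ u₃ u₄ u₅ p q j)) ∧
        ∃ t : Fin 5 → ℂ,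
          -- exactly five distinct roots are selected, and they are simple
          Function.Injective t ∧
          (∀ z : ℂ, ((transformedPoly p q).IsRoot z ∧ IsSelected z) ↔ ∃ i, z = t i) ∧
          (∀ i, (transformedPoly p q).rootMultiplicity (t i) = 1) ∧
          -- each site contains exactly one root
          (∀ i, ∀ z : ℂ,
            ((transformedPoly p q).IsRoot z ∧ z ∈ site u₂ u₃ u₄ u₅ p q i) ↔ z = t i) ∧
          -- together with the opposite roots these are all ten roots, with multiplicity
          (transformedPoly p q).roots =
            Finset.univ.val.map t + Finset.univ.val.map (fun i => -t i) := by
  obtain ⟨v₂, hv₂, ha₂⟩ := exists_quartic_root_upper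
  obtain ⟨v₃, hv₃, ha₃⟩ := exists_quartic_root_lower
  obtain ⟨v₄, hv₄, ha₄⟩ := exists_quartic_root_complex
  have hv₅ : (starRingEnd ℂ v₄) ^ 4 - 8 * (starRingEnd ℂ v₄) ^ 2 + 12 * (starRingEnd ℂ v₄) - 4
      = 0 := by
    have := congrArg (starRingEnd ℂ) hv₄
    simpa only [map_sub, map_add, map_mul, map_pow, Complex.conj_ofNat, map_zero] using this
  have hre₄ := abs_lt.1 ((Complex.abs_re_le_norm _).trans_lt ha₄)
  have him₄ := abs_lt.1 ((Complex.abs_im_le_norm _).trans_lt ha₄)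
  rw [Complex.sub_re] at hre₄
  rw [Complex.sub_im] at him₄
  have hb₂ := abs_le.1 ha₂
  have hb₃ := abs_le.1 ha₃
  norm_num at hre₄ him₄ hb₂ hb₃
  -- Separation and size of the roots of the quartic.
  have n₂ : ‖Complex.I * (v₂ : ℂ)‖ ≤ 3.44 := by
    rw [norm_mul, Complex.norm_I, one_mul, Complex.norm_real, Real.norm_eq_abs, abs_le]
    constructor <;> linarith
  have n₃ : ‖Complex.I * (v₃ : ℂ)‖ ≤ 3.44 := by
    rw [norm_mul, Complex.norm_I, one_mul, Complex.norm_real, Real.norm_eq_abs, abs_le]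
    constructor <;> linarith
  have n₄ : ‖Complex.I * v₄‖ ≤ 3.44 := by
    rw [norm_mul, Complex.norm_I, one_mul]
    have h1 : |v₄.re| ≤ 1.5 := abs_le.2 ⟨by linarith, by linarith⟩
    have h2 : |v₄.im| ≤ 0.5 := abs_le.2 ⟨by linarith, by linarith⟩
    linarith [Complex.norm_le_abs_re_add_abs_im v₄]
  have n₅ : ‖Complex.I * starRingEnd ℂ v₄‖ ≤ 3.44 := by
    rw [norm_mul, Complex.norm_conj, ← norm_mul]
    exact n₄
  have d₂₃ : 0.9 ≤ ‖Complex.I * (v₂ : ℂ) - Complex.I * (v₃ : ℂ)‖ := by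
    rw [← mul_sub, norm_mul, Complex.norm_I, one_mul]
    refine le_trans ?_ (Complex.re_le_norm _)
    simp only [Complex.sub_re, Complex.ofReal_re]
    linarith
  have d₂₄ : 0.9 ≤ ‖Complex.I * (v₂ : ℂ) - Complex.I * v₄‖ := by
    rw [← mul_sub, norm_mul, Complex.norm_I, one_mul, norm_sub_rev]
    refine le_trans ?_ (Complex.re_le_norm _)
    simp only [Complex.sub_re, Complex.ofReal_re]
    linarith
  have d₂₅ : 0.9 ≤ ‖Complex.I * (v₂ : ℂ) - Complex.I * starRingEnd ℂ v₄‖ := by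
    rw [← mul_sub, norm_mul, Complex.norm_I, one_mul, norm_sub_rev]
    refine le_trans ?_ (Complex.re_le_norm _)
    simp only [Complex.sub_re, Complex.ofReal_re, Complex.conj_re]
    linarith
  have d₃₄ : 0.9 ≤ ‖Complex.I * (v₃ : ℂ) - Complex.I * v₄‖ := by
    rw [← mul_sub, norm_mul, Complex.norm_I, one_mul, norm_sub_rev]
    refine le_trans ?_ (Complex.re_le_norm _)
    simp only [Complex.sub_re, Complex.ofReal_re]
    linarith
  have d₃₅ : 0.9 ≤ ‖Complex.I * (v₃ : ℂ) - Complex.I * starRingEnd ℂ v₄‖ := by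
    rw [← mul_sub, norm_mul, Complex.norm_I, one_mul, norm_sub_rev]
    refine le_trans ?_ (Complex.re_le_norm _)
    simp only [Complex.sub_re, Complex.ofReal_re, Complex.conj_re]
    linarith
  have d₄₅ : 0.9 ≤ ‖Complex.I * v₄ - Complex.I * starRingEnd ℂ v₄‖ := by
    rw [← mul_sub, norm_mul, Complex.norm_I, one_mul, norm_sub_rev]
    refine le_trans ?_ (Complex.im_le_norm _)
    simp only [Complex.sub_im, Complex.conj_im]
    linarith
  have ne_of : ∀ {a b : ℂ}, 0.9 ≤ ‖a - b‖ → a ≠ b := by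
    rintro a b h rfl
    norm_num at h
  have hc : (10 : ℝ) ^ (-9 : ℤ) = 1 / 10 ^ 9 := by norm_num
  rw [hc]
  refine ⟨Complex.I * (v₂ : ℂ), Complex.I * (v₃ : ℂ), Complex.I * v₄,
    Complex.I * starRingEnd ℂ v₄,
    centerQuartic_roots (by rw [eval_centerQuartic_I_mul]; exact_mod_cast hv₂)
      (by rw [eval_centerQuartic_I_mul]; exact_mod_cast hv₃)
      (by rw [eval_centerQuartic_I_mul, hv₄]) (by rw [eval_centerQuartic_I_mul, hv₅])
      (ne_of d₂₃) (ne_of d₂₄) (ne_of d₂₅) (ne_of d₃₄) (ne_of d₃₅) (ne_of d₄₅),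
    ?_, ?_, ?_, ?_, ?_⟩
  · have e : Complex.I * (v₂ : ℂ) - 0.4863801704 * Complex.I
        = Complex.I * ((v₂ - 0.4863801704 : ℝ) : ℂ) := by
      push_cast
      ring
    rw [e, norm_mul, Complex.norm_I, one_mul, Complex.norm_real, Real.norm_eq_abs]
    exact ha₂.trans_lt (by norm_num)
  · have e : Complex.I * (v₃ : ℂ) - (-3.439109107) * Complex.I
        = Complex.I * ((v₃ - -3.439109107 : ℝ) : ℂ) := by
      push_cast
      ring
    rw [e, norm_mul, Complex.norm_I, one_mul, Complex.norm_real, Real.norm_eq_abs]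
    exact ha₃.trans_lt (by norm_num)
  · have e : Complex.I * v₄ - (0.4600767354 + 1.476364468 * Complex.I)
        = Complex.I * (v₄ - ⟨1.476364468, -0.4600767354⟩) := by
      rw [Complex.mk_eq_add_mul_I]
      push_cast
      linear_combination (-0.4600767354 : ℂ) * Complex.I_sq
    rw [e, norm_mul, Complex.norm_I, one_mul]
    exact ha₄
  · have e : Complex.I * starRingEnd ℂ v₄ - (-0.4600767354 + 1.476364468 * Complex.I)
        = Complex.I * starRingEnd ℂ (v₄ - ⟨1.476364468, -0.4600767354⟩) := by
      rw [map_sub, Complex.mk_eq_add_mul_I, map_add, map_mul, Complex.conj_I, Complex.conj_ofReal,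
        Complex.conj_ofReal]
      push_cast
      linear_combination (0.4600767354 : ℂ) * Complex.I_sq
    rw [e, norm_mul, Complex.norm_I, one_mul, Complex.norm_conj]
    exact ha₄
  intro p q hpq hp
  have hp' : 0 < |p| := lt_of_le_of_ne (abs_nonneg p) hp.symm
  have hq : 0 < q := by linarith
  obtain ⟨x, rfl⟩ : ∃ x, p = x * q := ⟨p / q, by field_simp⟩
  have hx0 : x ≠ 0 := by
    rintro rfl
    simp at hp
  have hx : |x| ≤ 1 / 97 := by
    rw [abs_mul, abs_of_pos hq] at hpq
    have : (97 * |x|) * q ≤ 1 * q := by linarith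
    have := le_of_mul_le_mul_right this hq
    linarith
  set u₂ := Complex.I * (v₂ : ℂ)
  set u₃ := Complex.I * (v₃ : ℂ)
  set u₄ := Complex.I * v₄
  set u₅ := Complex.I * starRingEnd ℂ v₄
  have hscale : ∀ i s, (q : ℂ) ^ 2 * s ∈ site u₂ u₃ u₄ u₅ (x * q) q i
      ↔ s ∈ site u₂ u₃ u₄ u₅ x 1 i := by
    intro i s
    fin_cases i
    · exact scale_mem_realSite_iff hq
    all_goals exact scale_mem_diskSite_iff hq
  have hsel : ∀ i s, s ∈ site u₂ u₃ u₄ u₅ x 1 i → IsSelected s := by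
    intro i s hs
    fin_cases i
    · exact isSelected_of_mem_realSite hx hs
    · exact isSelected_of_im_pos (im_pos_of_mem_diskSite hx n₂ hs)
    · exact isSelected_of_im_pos (im_pos_of_mem_diskSite hx n₃ hs)
    · exact isSelected_of_im_pos (im_pos_of_mem_diskSite hx n₄ hs)
    · exact isSelected_of_im_pos (im_pos_of_mem_diskSite hx n₅ hs)
  have hreal : ∀ {u}, ‖u‖ ≤ 3.44 → Disjoint (realSite x 1) (diskSite u x 1) := by
    intro u hu
    rw [Set.disjoint_left]
    intro z h1 h2
    exact (im_pos_of_mem_diskSite hx hu h2).ne' (realSite_im_re hx h1).1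
  have hdisj : Pairwise (fun i j =>
      Disjoint (site u₂ u₃ u₄ u₅ x 1 i) (site u₂ u₃ u₄ u₅ x 1 j)) := by
    have e₂₃ := disjoint_diskSite hx hx0 n₂ n₃ d₂₃
    have e₂₄ := disjoint_diskSite hx hx0 n₂ n₄ d₂₄
    have e₂₅ := disjoint_diskSite hx hx0 n₂ n₅ d₂₅
    have e₃₄ := disjoint_diskSite hx hx0 n₃ n₄ d₃₄
    have e₃₅ := disjoint_diskSite hx hx0 n₃ n₅ d₃₅
    have e₄₅ := disjoint_diskSite hx hx0 n₄ n₅ d₄₅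
    intro i j hij
    fin_cases i <;> fin_cases j <;> first
      | exact absurd rfl hij
      | exact hreal ‹_›
      | exact (hreal ‹_›).symm
      | assumption
      | (refine Disjoint.symm ?_; assumption)
  have hex : ∀ i, ∃ s ∈ site u₂ u₃ u₄ u₅ x 1 i, (transformedPoly x 1).IsRoot s := by
    have h₄ : ‖v₄ - approxV‖ ≤ 1 / 100000 := by
      have h1 : ‖(⟨1.476364468, -0.4600767354⟩ : ℂ) - approxV‖ ≤ 9 / 1000000 := by
        apply norm_le_of_re_sq_add_im_sq_le (by norm_num)
        simp only [approxV, Complex.sub_re, Complex.sub_im]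
        norm_num
      have h2 := norm_sub_le_norm_sub_add_norm_sub v₄ ⟨1.476364468, -0.4600767354⟩ approxV
      linarith
    have hd := exists_isRoot_mem_diskSite_of_near_approxV hv₄ h₄ hx hx0
    intro i
    fin_cases i
    · exact exists_isRoot_mem_realSite hx hx0
    · exact exists_isRoot_mem_diskSite_upper hv₂ (by linarith) (by linarith) hx hx0
    · exact exists_isRoot_mem_diskSite_lower hv₃ (by linarith) (by linarith) hx hx0
    · exact hd
    · obtain ⟨z, hz, hzr⟩ := hd
      exact ⟨_, neg_conj_mem_diskSite hz, isRoot_neg_conj_transformedPoly hzr⟩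
  -- Every point is `q ^ 2 * s` for some `s`.
  have hq2 : (q : ℂ) ^ 2 ≠ 0 := pow_ne_zero 2 (Complex.ofReal_ne_zero.2 hq.ne')
  have hdisj' : Pairwise (fun i j => Disjoint (site u₂ u₃ u₄ u₅ (x * q) q i)
      (site u₂ u₃ u₄ u₅ (x * q) q j)) := by
    intro i j hij
    rw [Set.disjoint_left]
    intro z hz hz'
    obtain ⟨s, rfl⟩ : ∃ s, z = (q : ℂ) ^ 2 * s := ⟨z / (q : ℂ) ^ 2, (mul_div_cancel₀ z hq2).symm⟩
    exact Set.disjoint_left.1 (hdisj hij) ((hscale i s).1 hz) ((hscale j s).1 hz')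
  refine ⟨hdisj', roots_of_disjoint_selected (natDegree_transformedPoly _ _)
    (fun z => isRoot_neg_transformedPoly) hdisj' ?_ ?_⟩
  · intro i z hz
    obtain ⟨s, rfl⟩ : ∃ s, z = (q : ℂ) ^ 2 * s := ⟨z / (q : ℂ) ^ 2, (mul_div_cancel₀ z hq2).symm⟩
    exact (hsel i s ((hscale i s).1 hz)).scale hq
  · intro i
    obtain ⟨s, hs, hsr⟩ := hex i
    exact ⟨_, (hscale i s).2 hs, isRoot_scale hsr⟩
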